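/- Let $n$ be an integer and let $1<n<p<\infty$, $1\le q\le\infty$. For an open set $\Omega\subset\mathbf R^n$ and a (scalar or vector valued) measurable function $f$ on $\Omega$ let $f^*(t)=\inf\{v\ge 0:\ |\{x\in\Omega:|f(x)|>v\}|\le t\}$ and $f^{**}(t)=\frac1t\int_0^t f^*(s)\,ds$ for $t>0$. Put $$\|f\|_{L^{p,q}(\Omega)}=\Big(\int_0^\infty \big(t^{1/p}f^*(t)\big)^q\,\frac{dt}{t}\Big)^{1/q}\ \text{ if } q<\infty,\qquad \|f\|_{L^{p,\infty}(\Omega)}=\sup_{t>0}t^{1/p}f^*(t),$$ and let $\|f\|_{L^{(p,q)}(\Omega)}$ be defined in the same way with $f^{**}$ in place of $f^*$; $L^{(p,q)}(\Omega)$ is the space of measurable $f$ with $\|f\|_{L^{(p,q)}(\Omega)}<\infty$. Let $W^{1,(p,q)}(\Omega)$ be the space of $u\in L^{(p,q)}(\Omega)$ whose weak partial derivatives exist and lie in $L^{(p,q)}(\Omega)$; $\nabla u$ denotes the weak gradient. Write $u\in W^{1,(p,q)}_{loc}(\Omega)$ if $u\in W^{1,(p,q)}(\Omega')$ for every open $\Omega'$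 whose closure is a compact subset of $\Omega$. Let $H_0^{1,(p,q)}(\Omega)$ be the closure of $C_0^\infty(\Omega)$ with respect to the norm $\big(\|u\|_{L^{(p,q)}(\Omega)}^r+\|\nabla u\|_{L^{(p,q)}(\Omega;\mathbf R^n)}^r\big)^{1/r}$, $r=\min(p,q)$ (the closure of $\{(\varphi,\nabla\varphi):\varphi\in C_0^\infty(\Omega)\}$ in $L^{(p,q)}(\Omega)\times L^{(p,q)}(\Omega;\mathbf R^n)$). For $0<\alpha<1$ put $[u]_{0,\alpha;D}=\sup_{x,y\in D,\,x\ne y}|u(x)-u(y)|/|x-y|^{\alpha}$; $C^{0,\alpha}(\overline\Omega)$ is the space of continuous functions $u$ on $\overline\Omega$ with $[u]_{0,\alpha;\Omega}<\infty$, and $u$ is locally Hölder continuous in $\Omega$ with exponent $\alpha$ if $[u]_{0,\alpha;K}<\infty$ for every compact $K\subset\Omega$. A version of $u$ on $\Omega$ is a function equal to $u$ almost everywhere in $\Omega$. There is a constant $C=C(n,p,q)>0$, depending only on $n,p,q$, such that for every open set $\Omega\subset\mathbf R^n$ the following hold. (i) If $u\in W^{1,(p,q)}(\Omega)$ is compactly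 supported in $\Omega$, then $u$ has a version $\overline u\in C^{0,1-n/p}(\overline\Omega)$ with $$[\overline u]_{0,1-\frac np;\overline\Omega}\le C\,\|\nabla u\|_{L^{p,q}(\Omega;\mathbf R^n)}.$$ (ii) If $u\in W^{1,(p,q)}_{loc}(\Omega)$, then $u$ has a version that is locally Hölder continuous in $\Omega$ with exponent $1-\frac np$. (iii) If $u\in W^{1,(p,q)}_{loc}(\mathbf R^n)$ and $|\nabla u|\in L^{(p,q)}(\mathbf R^n)$, then $u$ has a version $\overline u\in C^{0,1-n/p}(\mathbf R^n)$ with $$[\overline u]_{0,1-\frac np;\mathbf R^n}\le C\,\|\nabla u\|_{L^{p,q}(\mathbf R^n;\mathbf R^n)}.$$ (iv) If $u\in H_0^{1,(p,q)}(\Omega)$, then $u$ has a weak gradient and a version $\overline u\in C^{0,1-n/p}(\overline\Omega)$ with $$[\overline u]_{0,1-\frac np;\overline\Omega}\le C\,\|\nabla u\|_{L^{p,q}(\Omega;\mathbf R^n)}.$$ No regularity of $\partial\Omega$ is assumed. -/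

import Mathlib

open MeasureTheory Set Filter Topology
open scoped ENNReal NNReal

noncomputable section

namespace SobolevLorentz

section Lorentz

variable {α F : Type*} [MeasurableSpace α] [NormedAddCommGroup F]

/-- The distribution function `λ_f(t) = |{x : |f(x)| > t}|`. For vector-valued `f` it is the
distribution function of `|f|`. -/
def distribFn (f : α → F) (μ : Measure α) (t : ℝ≥0∞) : ℝ≥0∞ :=
  μ {x | t < ‖f x‖ₑ}

/-- The nonincreasing rearrangement `f*(t) = inf {v ≥ 0 : λ_f(v) ≤ t}` (with `inf ∅ = ∞`). -/
def rearr (f : α → F) (μ : Measure α) (t : ℝ) : ℝ≥0∞ :=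
  sInf {v : ℝ≥0∞ | distribFn f μ v ≤ ENNReal.ofReal t}

/-- The maximal function `f**(t) = (1/t) ∫₀ᵗ f*(s) ds` of `f*`, for `t > 0`. -/
def maxRearr (f : α → F) (μ : Measure α) (t : ℝ) : ℝ≥0∞ :=
  (∫⁻ s in Ioo (0 : ℝ) t, rearr f μ s) / ENNReal.ofReal t

/-- For `g : (0, ∞) → [0, ∞]`, the quantity `(∫₀^∞ (t^{1/p} g(t))^q dt/t)^{1/q}` when `q < ∞`
and `sup_{t > 0} t^{1/p} g(t)` when `q = ∞`. -/
def weightedNorm (g : ℝ → ℝ≥0∞) (p : ℝ) (q : ℝ≥0∞) : ℝ≥0∞ :=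
  if q = ∞ then ⨆ t ∈ Ioi (0 : ℝ), ENNReal.ofReal t ^ (1 / p) * g t
  else (∫⁻ t in Ioi (0 : ℝ),
    (ENNReal.ofReal t ^ (1 / p) * g t) ^ q.toReal / ENNReal.ofReal t) ^ (1 / q.toReal)

/-- The Lorentz quasinorm `‖f‖_{L^{p,q}}`, defined through `f*`. -/
def lorentzQuasinorm (f : α → F) (p : ℝ) (q : ℝ≥0∞) (μ : Measure α) : ℝ≥0∞ :=
  weightedNorm (rearr f μ) p q

/-- The Lorentz norm `‖f‖_{L^{(p,q)}}`, defined through `f**`. -/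
def lorentzNorm (f : α → F) (p : ℝ) (q : ℝ≥0∞) (μ : Measure α) : ℝ≥0∞ :=
  weightedNorm (maxRearr f μ) p q

/-- Membership in the Lorentz space `L^{(p,q)}`. -/
def MemLorentz (f : α → F) (p : ℝ) (q : ℝ≥0∞) (μ : Measure α) : Prop :=
  AEStronglyMeasurable f μ ∧ lorentzNorm f p q μ < ∞

end Lorentz

section Sobolev

variable {n : ℕ}

/-- `φ ∈ C₀^∞(Ω)`, extended by zero to `ℝⁿ`. -/
def IsTestFunction (Ω : Set (EuclideanSpace ℝ (Fin n))) (φ : EuclideanSpace ℝ (Fin n) → ℝ) :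
    Prop :=
  ContDiff ℝ (⊤ : ℕ∞) φ ∧ HasCompactSupport φ ∧ tsupport φ ⊆ Ω

/-- `v` is the `i`-th weak partial derivative of `u` in the open set `Ω`. -/
def IsWeakPartial (Ω : Set (EuclideanSpace ℝ (Fin n))) (u : EuclideanSpace ℝ (Fin n) → ℝ)
    (i : Fin n) (v : EuclideanSpace ℝ (Fin n) → ℝ) : Prop :=
  LocallyIntegrableOn u Ω ∧ LocallyIntegrableOn v Ω ∧
    ∀ φ : EuclideanSpace ℝ (Fin n) → ℝ, IsTestFunction Ω φ →
      ∫ x in Ω, φ x * v x = -∫ x in Ω, fderiv ℝ φ x (EuclideanSpace.single i 1) * u x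

/-- `G` is the weak (distributional) gradient of `u` in the open set `Ω`. -/
def IsWeakGradient (Ω : Set (EuclideanSpace ℝ (Fin n))) (u : EuclideanSpace ℝ (Fin n) → ℝ)
    (G : EuclideanSpace ℝ (Fin n) → EuclideanSpace ℝ (Fin n)) : Prop :=
  ∀ i : Fin n, IsWeakPartial Ω u i (fun x => G x i)

/-- `u ∈ W^{1,(p,q)}(Ω)`: `u` and its weak partial derivatives lie in `L^{(p,q)}(Ω)`. Only the
values of `u` on `Ω` matter. -/
def MemW1 (Ω : Set (EuclideanSpace ℝ (Fin n))) (p : ℝ) (q : ℝ≥0∞)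
    (u : EuclideanSpace ℝ (Fin n) → ℝ) : Prop :=
  MemLorentz u p q (volume.restrict Ω) ∧
    ∃ G : EuclideanSpace ℝ (Fin n) → EuclideanSpace ℝ (Fin n),
      IsWeakGradient Ω u G ∧ ∀ i, MemLorentz (fun x => G x i) p q (volume.restrict Ω)

/-- `u ∈ W_loc^{1,(p,q)}(Ω)`: `u ∈ W^{1,(p,q)}(Ω')` for every open `Ω' ⊂⊂ Ω`. -/
def MemW1Loc (Ω : Set (EuclideanSpace ℝ (Fin n))) (p : ℝ) (q : ℝ≥0∞)
    (u : EuclideanSpace ℝ (Fin n) → ℝ) : Prop :=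
  ∀ Ω' : Set (EuclideanSpace ℝ (Fin n)), IsOpen Ω' → IsCompact (closure Ω') → closure Ω' ⊆ Ω →
    MemW1 Ω' p q u

/-- The norm `(‖u‖^r + ‖G‖^r)^{1/r}`, `r = min(p, q)`, of a pair `(u, G)`, where `‖·‖` is the norm
of `L^{(p,q)}(Ω)`. For smooth `u` and `G = ∇u` it is the Sobolev-Lorentz `(p,q)`-norm of `u`. -/
def sobolevLorentzNorm (Ω : Set (EuclideanSpace ℝ (Fin n))) (p : ℝ) (q : ℝ≥0∞)
    (u : EuclideanSpace ℝ (Fin n) → ℝ)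
    (G : EuclideanSpace ℝ (Fin n) → EuclideanSpace ℝ (Fin n)) : ℝ≥0∞ :=
  (lorentzNorm u p q (volume.restrict Ω) ^ (min (ENNReal.ofReal p) q).toReal +
    lorentzNorm G p q (volume.restrict Ω) ^ (min (ENNReal.ofReal p) q).toReal) ^
      (1 / (min (ENNReal.ofReal p) q).toReal)

/-- `u ∈ H₀^{1,(p,q)}(Ω)`, the closure of `C₀^∞(Ω)` in the Sobolev-Lorentz `(p,q)`-norm, where the
completion is realized in the Banach space `L^{(p,q)}(Ω) × L^{(p,q)}(Ω; ℝⁿ)` through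
`φ ↦ (φ, ∇φ)`. -/
def MemH01 (Ω : Set (EuclideanSpace ℝ (Fin n))) (p : ℝ) (q : ℝ≥0∞)
    (u : EuclideanSpace ℝ (Fin n) → ℝ) : Prop :=
  MemLorentz u p q (volume.restrict Ω) ∧
    ∃ G : EuclideanSpace ℝ (Fin n) → EuclideanSpace ℝ (Fin n),
      MemLorentz G p q (volume.restrict Ω) ∧
        ∀ ε : ℝ≥0∞, 0 < ε → ∃ φ : EuclideanSpace ℝ (Fin n) → ℝ, IsTestFunction Ω φ ∧
          sobolevLorentzNorm Ω p q (fun x => φ x - u x) (fun x => gradient φ x - G x) < ε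

/-- `u` is compactly supported in `Ω` (as an element of a space of functions modulo equality
almost everywhere). -/
def CompactlySupportedIn (Ω : Set (EuclideanSpace ℝ (Fin n)))
    (u : EuclideanSpace ℝ (Fin n) → ℝ) : Prop :=
  ∃ K : Set (EuclideanSpace ℝ (Fin n)), IsCompact K ∧ K ⊆ Ω ∧
    ∀ᵐ x ∂(volume.restrict Ω), x ∉ K → u x = 0

/-- The Hölder seminorm `[u]_{0,a;D} = sup_{x ≠ y in D} |u(x) - u(y)| / |x - y|^a`. -/
def holderSeminorm (a : ℝ) (D : Set (EuclideanSpace ℝ (Fin n)))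
    (u : EuclideanSpace ℝ (Fin n) → ℝ) : ℝ≥0∞ :=
  ⨆ (x ∈ D) (y ∈ D) (_ : x ≠ y), ‖u x - u y‖ₑ / ‖x - y‖ₑ ^ a

/-- `u` is locally Hölder continuous in `D` with exponent `a`. -/
def LocallyHolder (a : ℝ) (D : Set (EuclideanSpace ℝ (Fin n)))
    (u : EuclideanSpace ℝ (Fin n) → ℝ) : Prop :=
  ∀ K : Set (EuclideanSpace ℝ (Fin n)), IsCompact K → K ⊆ D → holderSeminorm a K u < ∞

/-- `u ∈ C^{0,a}(closure of Ω)`: `u` is continuous on the closure of `Ω` and Hölder continuous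
in `Ω` with exponent `a`. Only the values of `u` on the closure of `Ω` matter. -/
def MemHolderClosure (a : ℝ) (Ω : Set (EuclideanSpace ℝ (Fin n)))
    (u : EuclideanSpace ℝ (Fin n) → ℝ) : Prop :=
  ContinuousOn u (closure Ω) ∧ holderSeminorm a Ω u < ∞

/-- `w` is a version of `u` on `Ω`. -/
def IsVersion (Ω : Set (EuclideanSpace ℝ (Fin n))) (w u : EuclideanSpace ℝ (Fin n) → ℝ) : Prop :=
  w =ᵐ[volume.restrict Ω] u

end Sobolev

end SobolevLorentz

end

open SobolevLorentz

/-! The theorem is Morrey's inequality under a condition on the gradient that sees only its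
integrals over balls. Set `a = 1 - n/p`. Every `L^{p,q}` embeds in weak `L^p`, and a weak `L^p`
function has integral at most a constant times `|S|^(1 - 1/p)` over a set `S` of finite measure. For
a ball of radius `r` this is a constant times `r^(n - 1 + a)`, because `n(1 - 1/p) = n - 1 + a`.
This is `MorreyBound`, and `q` enters only through the constant
(`morreyBound_of_lorentzQuasinorm_le`).

For `C^1` functions the Morrey bound on the derivative gives `|f x - f y| ≤ c K |x - y|^a`
(`dist_le_of_morreyBound`). Mollification keeps the bound with the same `K`, since the condition is
invariant under translation. Letting the mollifiers shrink gives a Hölder version of any function on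
the whole space whose weak gradient satisfies the bound (`exists_holderWith_of_morreyBound`).

The four assertions reduce to this one by moving to the whole space. A compactly supported `u` is
replaced by `η u`, with a cutoff `η` equal to 1 near the support, so that `u ∇η` vanishes. In the
local case `u ∇η` survives, but `u` is itself in `L^{p,q}` and satisfies a Morrey bound with the
same exponent. An element of `H₀` is extended by zero, and its gradient extends by zero as well
because it is a limit of test functions. No step uses the boundary of `Ω`. -/

namespace SobolevLorentz

/-! ### Lorentz quasinorms, weak `L^p`, and integrals over sets of finite measure -/

section LorentzBounds
variable {α F : Type*} [MeasurableSpace α] [NormedAddCommGroup F]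

lemma distribFn_antitone (f : α → F) (μ : Measure α) : Antitone (distribFn f μ) :=
  fun _ _ hst => measure_mono fun _ hx => lt_of_le_of_lt hst hx

lemma rearr_antitone (f : α → F) (μ : Measure α) : Antitone (rearr f μ) :=
  fun _ _ hst => sInf_le_sInf fun _ hv => le_trans hv (ENNReal.ofReal_le_ofReal hst)

lemma le_rearr {f : α → F} {μ : Measure α} {v : ℝ≥0∞} {t : ℝ}
    (h : ENNReal.ofReal t < distribFn f μ v) : v ≤ rearr f μ t := by
  refine le_sInf fun w hw => ?_
  by_contra! hlt
  exact absurd (h.trans_le ((distribFn_antitone f μ hlt.le).trans hw)) (lt_irrefl _)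

/-- As `f*` is nonincreasing, its mean over `(0, t)` is at least its value at `t`. This lets the
spaces be defined by `f**` while the estimates are stated with `f*`. -/
lemma rearr_le_maxRearr (f : α → F) (μ : Measure α) {t : ℝ} (ht : 0 < t) :
    rearr f μ t ≤ maxRearr f μ t := by
  have ht' : ENNReal.ofReal t ≠ 0 := by simpa using ht
  rw [maxRearr, ENNReal.le_div_iff_mul_le (Or.inl ht') (Or.inl ENNReal.ofReal_ne_top)]
  calc rearr f μ t * ENNReal.ofReal t = ∫⁻ _ in Ioo (0 : ℝ) t, rearr f μ t := by
        simp
    _ ≤ _ := setLIntegral_mono' measurableSet_Ioo fun s hs => rearr_antitone f μ hs.2.le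

lemma weightedNorm_mono {g h : ℝ → ℝ≥0∞} {p : ℝ} {q : ℝ≥0∞} (hgh : ∀ t, 0 < t → g t ≤ h t) :
    weightedNorm g p q ≤ weightedNorm h p q := by
  unfold weightedNorm
  split_ifs with hq
  · exact iSup₂_mono fun t ht => mul_le_mul_right (hgh t ht) _
  · refine ENNReal.rpow_le_rpow (setLIntegral_mono' measurableSet_Ioi fun t ht => ?_) (by positivity)
    gcongr
    exact hgh t ht

lemma lorentzQuasinorm_le_lorentzNorm (f : α → F) (p : ℝ) (q : ℝ≥0∞) (μ : Measure α) :
    lorentzQuasinorm f p q μ ≤ lorentzNorm f p q μ :=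
  weightedNorm_mono fun _ ht => rearr_le_maxRearr f μ ht

/-- The norm of the embedding `L^{p,q} ⊂ L^{p,∞}`. -/
noncomputable def weakConst (p : ℝ) (q : ℝ≥0∞) : ℝ≥0 :=
  if q = ∞ then 1 else Real.toNNReal ((q.toReal / p) ^ (1 / q.toReal))

lemma lintegral_rpow_sub_one {s t : ℝ} (hs : 0 < s) (ht : 0 < t) :
    ∫⁻ x in Ioc 0 t, ENNReal.ofReal x ^ (s - 1) = ENNReal.ofReal (t ^ s / s) := by
  have h1 : ∫⁻ x in Ioc 0 t, ENNReal.ofReal x ^ (s - 1) =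
      ∫⁻ x in Ioc 0 t, ENNReal.ofReal (x ^ (s - 1)) :=
    setLIntegral_congr_fun measurableSet_Ioc fun x hx => by
      simp only [ENNReal.ofReal_rpow_of_pos hx.1]
  rw [h1, ← ofReal_integral_eq_lintegral_ofReal]
  · rw [← intervalIntegral.integral_of_le ht.le, integral_rpow (Or.inl (by linarith))]
    simp [Real.zero_rpow hs.ne']
  · exact (intervalIntegrable_iff_integrableOn_Ioc_of_le ht.le).1
      (intervalIntegral.intervalIntegrable_rpow' (by linarith))
  · filter_upwards [self_mem_ae_restrict measurableSet_Ioc] with x hx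
    exact Real.rpow_nonneg hx.1.le _

/-- For `q < ∞`, keep only the part of the integral over `(0, t]`, where `g ≥ v`. There `∫ s^(q/p -
1) ds = t^(q/p) / (q/p)`, and the `q`-th root produces the factor in `weakConst`. -/
lemma mul_rpow_le_weightedNorm {g : ℝ → ℝ≥0∞} {p : ℝ} {q : ℝ≥0∞} (hp : 0 < p) (hq : 1 ≤ q)
    {v : ℝ≥0∞} {t : ℝ} (ht : 0 < t) (hg : ∀ s, 0 < s → s ≤ t → v ≤ g s) :
    v * ENNReal.ofReal t ^ (1 / p) ≤ weakConst p q * weightedNorm g p q := by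
  unfold weakConst weightedNorm
  split_ifs with hq'
  · rw [ENNReal.coe_one, one_mul, mul_comm]
    exact (mul_le_mul_right (hg t ht le_rfl) _).trans (le_iSup₂_of_le t ht le_rfl)
  · set r := q.toReal with hr
    have hr0 : 0 < r := ENNReal.toReal_pos (by positivity) hq'
    have hrp : 0 < r / p := by positivity
    have key : v ^ r * ENNReal.ofReal (t ^ (r / p) / (r / p)) ≤
        ∫⁻ s in Ioi (0 : ℝ), (ENNReal.ofReal s ^ (1 / p) * g s) ^ r / ENNReal.ofReal s := by
      rw [← lintegral_rpow_sub_one hrp ht, ← lintegral_const_mul _ (by fun_prop)]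
      refine le_trans ?_ (lintegral_mono_set (show Ioc 0 t ⊆ Ioi 0 from Ioc_subset_Ioi_self))
      refine setLIntegral_mono' measurableSet_Ioc fun s hs => ?_
      have h0 : ENNReal.ofReal s ≠ 0 := by simpa using hs.1
      rw [ENNReal.rpow_sub _ _ h0 ENNReal.ofReal_ne_top, ENNReal.rpow_one, ← mul_div_assoc]
      gcongr
      rw [ENNReal.mul_rpow_of_nonneg _ _ hr0.le, ← ENNReal.rpow_mul, mul_comm,
        one_div_mul_eq_div]
      gcongr
      exact hg s hs.1 hs.2
    have h2 := ENNReal.rpow_le_rpow key (z := 1 / r) (by positivity)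
    calc v * ENNReal.ofReal t ^ (1 / p)
        = ENNReal.ofReal ((r / p) ^ (1 / r)) *
          (v ^ r * ENNReal.ofReal (t ^ (r / p) / (r / p))) ^ (1 / r) := by
          rw [ENNReal.mul_rpow_of_nonneg _ _ (by positivity), ← ENNReal.rpow_mul,
            mul_one_div_cancel hr0.ne', ENNReal.rpow_one, mul_left_comm,
            ENNReal.ofReal_rpow_of_pos (x := t ^ (r / p) / (r / p)) (by positivity),
            ← ENNReal.ofReal_mul (by positivity),
            ENNReal.ofReal_rpow_of_pos ht, ← Real.mul_rpow (by positivity) (by positivity),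
            mul_div_cancel₀ _ hrp.ne', ← Real.rpow_mul ht.le]
          congr 3
          field_simp
      _ ≤ _ := mul_le_mul_right h2 _

/-- The embedding of `L^{p,q}` into weak `L^p`. -/
lemma mul_distribFn_rpow_le (f : α → F) {p : ℝ} {q : ℝ≥0∞} (hp : 0 < p) (hq : 1 ≤ q)
    (μ : Measure α) (v : ℝ≥0∞) :
    v * distribFn f μ v ^ (1 / p) ≤ weakConst p q * lorentzQuasinorm f p q μ := by
  -- The inequality `v ≤ f*(t)` needs `t` strictly below the distribution function. The endpoint,
  -- possibly infinite, is reached by letting `t` increase to it.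
  have h1 : ∀ t : ℝ≥0∞, t < distribFn f μ v →
      v * t ^ (1 / p) ≤ weakConst p q * lorentzQuasinorm f p q μ := by
    intro t ht
    lift t to ℝ≥0 using ht.ne_top
    rcases eq_or_lt_of_le (zero_le (a := t)) with rfl | h0
    · simp [hp]
    have ht' : ENNReal.ofReal t < distribFn f μ v := by simpa using ht
    have := mul_rpow_le_weightedNorm (g := rearr f μ) hp hq (v := v) (t := t) (by exact_mod_cast h0)
      fun s _ hs => (le_rearr ht').trans (rearr_antitone f μ hs)
    simpa [lorentzQuasinorm] using this
  rcases eq_or_ne (distribFn f μ v) 0 with h0 | h0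
  · simp [h0, hp]
  have hcont : Tendsto (fun t : ℝ≥0∞ => v * t ^ (1 / p)) (𝓝[<] distribFn f μ v)
      (𝓝 (v * distribFn f μ v ^ (1 / p))) := by
    refine ENNReal.Tendsto.const_mul ?_ (Or.inl (by simp [h0, hp.le]))
    exact ((ENNReal.continuous_rpow_const).tendsto _).mono_left nhdsWithin_le_nhds
  have : (𝓝[<] distribFn f μ v).NeBot := nhdsLT_neBot_of_exists_lt ⟨0, pos_iff_ne_zero.2 h0⟩
  exact le_of_tendsto hcont (by filter_upwards [self_mem_nhdsWithin] with t ht using h1 t ht)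

lemma lintegral_Ioi_div_rpow {p b v : ℝ} (hp : 1 < p) (hb : 0 ≤ b) (hv : 0 < v) :
    ∫⁻ t in Ioi v, ENNReal.ofReal ((b / t) ^ p) =
      ENNReal.ofReal (b ^ p * (v ^ (1 - p) / (p - 1))) := by
  have h1 : ∫⁻ t in Ioi v, ENNReal.ofReal ((b / t) ^ p) =
      ∫⁻ t in Ioi v, ENNReal.ofReal (b ^ p * t ^ (-p)) :=
    setLIntegral_congr_fun measurableSet_Ioi fun t ht => by
      have ht0 : 0 < t := hv.trans ht
      rw [Real.div_rpow hb ht0.le, Real.rpow_neg ht0.le, div_eq_mul_inv]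
  rw [h1, ← ofReal_integral_eq_lintegral_ofReal]
  · rw [integral_const_mul, integral_Ioi_rpow_of_lt (by linarith) hv]
    congr 2
    rw [show (-p + 1) = -(p - 1) by ring, neg_div_neg_eq, show -(p - 1) = 1 - p by ring]
  · exact (integrableOn_Ioi_rpow_of_lt (by linarith) hv).const_mul _
  · filter_upwards [self_mem_ae_restrict measurableSet_Ioi] with t ht
    have ht0 : 0 < t := hv.trans ht
    positivity

/-- A function in weak `L^p` is integrable on sets of finite measure. -/
lemma setLIntegral_le_of_weak {f : α → F} {μ : Measure α} (hf : AEStronglyMeasurable f μ) {p : ℝ}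
    (hp : 1 < p) {B : ℝ≥0} (hB : ∀ v, v * distribFn f μ v ^ (1 / p) ≤ B) {S : Set α}
    {m : ℝ≥0} (hm : μ S ≤ m) (hm0 : 0 < m) :
    ∫⁻ x in S, ‖f x‖ₑ ∂μ ≤
      ENNReal.ofReal (p / (p - 1)) * B * (m : ℝ≥0∞) ^ (1 - 1 / p) := by
  have hp0 : 0 < p := by linarith
  have hp1 : 0 < p - 1 := by linarith
  -- The splitting level below must be positive and `B` may be 0, so a positive `b ≥ B` is used
  -- first and then sent to `B` from above.
  have key : ∀ b : ℝ, 0 < b → B ≤ b → ∫⁻ x in S, ‖f x‖ₑ ∂μ ≤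
      ENNReal.ofReal (p / (p - 1)) * ENNReal.ofReal b * (m : ℝ≥0∞) ^ (1 - 1 / p) := by
    intro b hb hBb
    have hmr : (0 : ℝ) < m := hm0
    have h1 : ∫⁻ x in S, ‖f x‖ₑ ∂μ =
        ∫⁻ t in Ioi (0 : ℝ), μ.restrict S {a | t < ‖f a‖} := by
      rw [← lintegral_eq_lintegral_meas_lt _ (Eventually.of_forall fun _ => norm_nonneg _)
        hf.restrict.norm.aemeasurable]
      simp
    -- The level at which the two bounds for the distribution function on `S`, namely `m` and `(b /
    -- t)^p`, coincide.
    set v := b * (m : ℝ) ^ (-(1 / p)) with hv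
    have hv0 : 0 < v := by positivity
    have h2 : ∫⁻ t in Ioc (0 : ℝ) v, μ.restrict S {a | t < ‖f a‖} ≤
        ENNReal.ofReal (m * v) := by
      calc _ ≤ ∫⁻ t in Ioc (0 : ℝ) v, (m : ℝ≥0∞) := by
            refine lintegral_mono fun t => ?_
            refine (measure_mono (subset_univ _)).trans ?_
            simpa using hm
        _ = _ := by simp [ENNReal.ofReal_mul]
    have h3 : ∫⁻ t in Ioi v, μ.restrict S {a | t < ‖f a‖} ≤
        ENNReal.ofReal (b ^ p * (v ^ (1 - p) / (p - 1))) := by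
      rw [← lintegral_Ioi_div_rpow hp hb.le hv0]
      refine setLIntegral_mono' measurableSet_Ioi fun t ht => ?_
      have ht0 : 0 < t := hv0.trans ht
      refine (Measure.restrict_apply_le _ _).trans ?_
      have hd : μ {a | t < ‖f a‖} = distribFn f μ (ENNReal.ofReal t) := by
        unfold distribFn
        congr 1
        ext a
        simp only [mem_ofPred_eq]
        rw [← ofReal_norm, ENNReal.ofReal_lt_ofReal_iff_of_nonneg ht0.le]
      rw [hd]
      have hB' := hB (ENNReal.ofReal t)
      have ht' : ENNReal.ofReal t ≠ 0 := by simpa using ht0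
      have h4 : distribFn f μ (ENNReal.ofReal t) ^ (1 / p) ≤ ENNReal.ofReal (b / t) := by
        rw [ENNReal.ofReal_div_of_pos ht0,
          ENNReal.le_div_iff_mul_le (Or.inl ht') (Or.inl ENNReal.ofReal_ne_top), mul_comm]
        refine hB'.trans ?_
        rw [← ENNReal.ofReal_coe_nnreal]
        exact ENNReal.ofReal_le_ofReal hBb
      have h5 := ENNReal.rpow_le_rpow h4 hp0.le
      rwa [← ENNReal.rpow_mul, one_div_mul_cancel hp0.ne', ENNReal.rpow_one,
        ENNReal.ofReal_rpow_of_pos (by positivity)] at h5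
    have h6 : (m : ℝ) * v + b ^ p * (v ^ (1 - p) / (p - 1)) =
        p / (p - 1) * b * (m : ℝ) ^ (1 - 1 / p) := by
      have e1 : v ^ (1 - p) = b ^ (1 - p) * (m : ℝ) ^ (1 - 1 / p) := by
        rw [hv, Real.mul_rpow hb.le (by positivity), ← Real.rpow_mul hmr.le]
        congr 2
        field_simp
        ring
      have e2 : (m : ℝ) * v = b * (m : ℝ) ^ (1 - 1 / p) := by
        rw [hv, sub_eq_add_neg, Real.rpow_add hmr, Real.rpow_one]
        ring
      have e3 : b ^ p * b ^ (1 - p) = b := by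
        rw [← Real.rpow_add hb]; simp
      rw [e1, e2, mul_div_assoc', ← mul_assoc, e3]
      field_simp
      ring
    rw [h1, ← Ioc_union_Ioi_eq_Ioi hv0.le, lintegral_union measurableSet_Ioi
      (Ioc_disjoint_Ioi le_rfl)]
    refine (add_le_add h2 h3).trans (le_of_eq ?_)
    rw [← ENNReal.ofReal_add (by positivity) (by positivity), h6,
      ENNReal.ofReal_mul (by positivity), ENNReal.ofReal_mul (by positivity),
      ← ENNReal.ofReal_rpow_of_pos hmr, ENNReal.ofReal_coe_nnreal]
  have hlim : Tendsto (fun b : ℝ => ENNReal.ofReal (p / (p - 1)) * ENNReal.ofReal b *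
      (m : ℝ≥0∞) ^ (1 - 1 / p)) (𝓝[>] (B : ℝ))
      (𝓝 (ENNReal.ofReal (p / (p - 1)) * ENNReal.ofReal B * (m : ℝ≥0∞) ^ (1 - 1 / p))) := by
    have hne : (m : ℝ≥0∞) ^ (1 - 1 / p) ≠ ∞ :=
      ENNReal.rpow_ne_top_of_ne_zero (by simpa using hm0.ne') ENNReal.coe_ne_top
    refine ENNReal.Tendsto.mul_const (ENNReal.Tendsto.const_mul ?_
      (Or.inr ENNReal.ofReal_ne_top)) (Or.inr hne)
    exact (ENNReal.continuous_ofReal.tendsto _).mono_left nhdsWithin_le_nhds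
  rw [ENNReal.ofReal_coe_nnreal] at hlim
  refine ge_of_tendsto hlim ?_
  filter_upwards [self_mem_nhdsWithin] with b hb
  exact key b (B.2.trans_lt hb) (le_of_lt hb)

end LorentzBounds

/-! ### Morrey's estimate for smooth functions, and extension of Hölder functions -/

section Morrey
variable {n : ℕ}

/-- The Morrey condition `∫_{B(x,r)} g ≤ K r^{n-1+a}` for all balls. -/
def MorreyBound (g : EuclideanSpace ℝ (Fin n) → ℝ≥0∞) (K : ℝ≥0) (a : ℝ) : Prop :=
  ∀ (x : EuclideanSpace ℝ (Fin n)) (r : ℝ), 0 < r →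
    ∫⁻ y in Metric.ball x r, g y ≤ K * ENNReal.ofReal (r ^ (n - 1 + a))

lemma MorreyBound.add {g h : EuclideanSpace ℝ (Fin n) → ℝ≥0∞} {K L : ℝ≥0} {a : ℝ}
    (hg : MorreyBound g K a) (hh : MorreyBound h L a) (hm : AEMeasurable g) :
    MorreyBound (fun x => g x + h x) (K + L) a := fun x r hr => by
  rw [lintegral_add_left' hm.restrict, ENNReal.coe_add, add_mul]
  exact add_le_add (hg x r hr) (hh x r hr)

lemma MorreyBound.mono {g h : EuclideanSpace ℝ (Fin n) → ℝ≥0∞} {K : ℝ≥0} {a : ℝ}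
    (hg : MorreyBound g K a) (hh : ∀ᵐ x, h x ≤ g x) : MorreyBound h K a := fun x r hr =>
  (lintegral_mono_ae (ae_restrict_of_ae hh)).trans (hg x r hr)

lemma MorreyBound.const_mul {g : EuclideanSpace ℝ (Fin n) → ℝ≥0∞} {K : ℝ≥0} {a : ℝ}
    (hg : MorreyBound g K a) (c : ℝ≥0) : MorreyBound (fun x => c * g x) (c * K) a :=
  fun x r hr => by
  rw [lintegral_const_mul' _ _ ENNReal.coe_ne_top, ENNReal.coe_mul, mul_assoc]
  exact mul_le_mul_right (hg x r hr) _

lemma lintegral_ball_comp_homothety {g : EuclideanSpace ℝ (Fin n) → ℝ≥0∞} (hg : Measurable g)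
    (x : EuclideanSpace ℝ (Fin n)) (R : ℝ) {t : ℝ} (ht : 0 < t) :
    ∫⁻ w in Metric.ball x R, g (x + t • (w - x)) =
      ENNReal.ofReal ((t ^ n)⁻¹) * ∫⁻ y in Metric.ball x (t * R), g y := by
  have hm : Measurable ((Metric.ball x (t * R)).indicator g) :=
    hg.indicator Metric.isOpen_ball.measurableSet
  have h1 : ∀ w, (Metric.ball x R).indicator (fun w => g (x + t • (w - x))) w =
      (Metric.ball x (t * R)).indicator g (x + t • (w - x)) := by
    intro w
    have : w ∈ Metric.ball x R ↔ x + t • (w - x) ∈ Metric.ball x (t * R) := by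
      simp [Metric.mem_ball, dist_eq_norm, norm_smul, abs_of_pos ht, ht]
    by_cases hw : w ∈ Metric.ball x R
    · rw [indicator_of_mem hw, indicator_of_mem (this.1 hw)]
    · rw [indicator_of_notMem hw, indicator_of_notMem (this.not.1 hw)]
  rw [← lintegral_indicator Metric.isOpen_ball.measurableSet, lintegral_congr h1,
    lintegral_sub_right_eq_self (fun z => (Metric.ball x (t * R)).indicator g (x + t • z)) x,
    ← lintegral_map (f := fun z => (Metric.ball x (t * R)).indicator g (x + z))
      (hm.comp (measurable_const_add x)) (measurable_const_smul t),
    Measure.map_addHaar_smul _ ht.ne', lintegral_smul_measure,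
    lintegral_add_left_eq_self, lintegral_indicator Metric.isOpen_ball.measurableSet]
  simp [abs_of_pos ht]

lemma enorm_sub_le_lintegral_fderiv {f : EuclideanSpace ℝ (Fin n) → ℝ} (hf : ContDiff ℝ 1 f)
    (x w : EuclideanSpace ℝ (Fin n)) :
    ‖f w - f x‖ₑ ≤ ‖w - x‖ₑ * ∫⁻ t in Ioc (0 : ℝ) 1, ‖fderiv ℝ f (x + t • (w - x))‖ₑ := by
  have hd : ∀ t : ℝ, HasDerivAt (fun t : ℝ => f (x + t • (w - x)))
      (fderiv ℝ f (x + t • (w - x)) (w - x)) t := by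
    intro t
    have h1 : HasDerivAt (fun t : ℝ => x + t • (w - x)) (w - x) t := by
      simpa using ((hasDerivAt_id t).smul_const (w - x)).const_add x
    exact ((hf.differentiable one_ne_zero _).hasFDerivAt).comp_hasDerivAt t h1
  have hc : Continuous fun t : ℝ => fderiv ℝ f (x + t • (w - x)) :=
    (hf.continuous_fderiv one_ne_zero).comp (by fun_prop)
  have h2 := intervalIntegral.integral_eq_sub_of_hasDerivAt (a := 0) (b := 1)
    (fun t _ => hd t) ((hc.clm_apply continuous_const).intervalIntegrable _ _)
  have h3 : f w - f x = ∫ t in (0 : ℝ)..1, fderiv ℝ f (x + t • (w - x)) (w - x) := by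
    rw [h2]; simp
  rw [h3, intervalIntegral.integral_of_le zero_le_one,
    ← lintegral_const_mul _ (hc.enorm.measurable)]
  refine (enorm_integral_le_lintegral_enorm _).trans (lintegral_mono fun t => ?_)
  rw [mul_comm]
  exact ContinuousLinearMap.le_opENorm _ _

/-- Integrate along the segments from `x` and exchange the integrals. The dilation `w ↦ x + t(w -
x)` costs `t^(-n)`, and the Morrey bound on `B(x, tR)` returns `t^(n - 1 + a)`. What remains is `∫₀¹
t^(a - 1) dt = 1/a`, finite because `a > 0`. -/
lemma lintegral_ball_enorm_sub_le {f : EuclideanSpace ℝ (Fin n) → ℝ} (hf : ContDiff ℝ 1 f)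
    {K : ℝ≥0} {a : ℝ} (ha : 0 < a) (hK : MorreyBound (fun x => ‖fderiv ℝ f x‖ₑ) K a)
    (x : EuclideanSpace ℝ (Fin n)) {R : ℝ} (hR : 0 < R) :
    ∫⁻ w in Metric.ball x R, ‖f w - f x‖ₑ ≤ ENNReal.ofReal (K * R ^ (n + a) / a) := by
  have hc : Continuous fun y => ‖fderiv ℝ f y‖ₑ := (hf.continuous_fderiv one_ne_zero).enorm
  have hc2 : Continuous (Function.uncurry fun (w : EuclideanSpace ℝ (Fin n)) (t : ℝ) =>
      ‖fderiv ℝ f (x + t • (w - x))‖ₑ) := hc.comp (by fun_prop)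
  calc ∫⁻ w in Metric.ball x R, ‖f w - f x‖ₑ
      ≤ ∫⁻ w in Metric.ball x R, ENNReal.ofReal R *
          ∫⁻ t in Ioc (0 : ℝ) 1, ‖fderiv ℝ f (x + t • (w - x))‖ₑ := by
        refine setLIntegral_mono' Metric.isOpen_ball.measurableSet fun w hw => ?_
        refine (enorm_sub_le_lintegral_fderiv hf x w).trans ?_
        gcongr
        rw [← ofReal_norm, ← dist_eq_norm]
        exact ENNReal.ofReal_le_ofReal (Metric.mem_ball.1 hw).le
    _ = ENNReal.ofReal R * ∫⁻ t in Ioc (0 : ℝ) 1,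
          ∫⁻ w in Metric.ball x R, ‖fderiv ℝ f (x + t • (w - x))‖ₑ := by
        rw [lintegral_const_mul' _ _ ENNReal.ofReal_ne_top,
          lintegral_lintegral_swap hc2.measurable.aemeasurable]
    _ ≤ ENNReal.ofReal R * ∫⁻ t in Ioc (0 : ℝ) 1,
          ENNReal.ofReal (K * R ^ (n - 1 + a)) * ENNReal.ofReal t ^ (a - 1) := by
        refine mul_le_mul_right (setLIntegral_mono' measurableSet_Ioc fun t ht => ?_) _
        have ht0 : 0 < t := ht.1
        rw [lintegral_ball_comp_homothety hc.measurable x R ht0]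
        refine (mul_le_mul_right (hK x (t * R) (by positivity)) _).trans (le_of_eq ?_)
        rw [← ENNReal.ofReal_coe_nnreal, ENNReal.ofReal_rpow_of_pos ht0,
          ← ENNReal.ofReal_mul (by positivity), ← ENNReal.ofReal_mul (by positivity),
          ← ENNReal.ofReal_mul (by positivity)]
        congr 1
        rw [Real.mul_rpow ht0.le hR.le, show (n : ℝ) - 1 + a = n + (a - 1) by ring,
          Real.rpow_add ht0, Real.rpow_natCast]
        field_simp
    _ = _ := by
        rw [lintegral_const_mul' _ _ ENNReal.ofReal_ne_top,
          lintegral_rpow_sub_one ha zero_lt_one, ← ENNReal.ofReal_mul (by positivity),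
          ← ENNReal.ofReal_mul (by positivity)]
        congr 1
        rw [show (n : ℝ) + a = 1 + (n - 1 + a) by ring, Real.rpow_add hR 1, Real.rpow_one,
          Real.one_rpow]
        ring

/-- The constant of the Morrey estimate. -/
noncomputable def morreyConst (n : ℕ) (a : ℝ) : ℝ :=
  2 ^ (n + 1) / (a * (volume (Metric.ball (0 : EuclideanSpace ℝ (Fin n)) 1)).toReal)

lemma morreyConst_nonneg (n : ℕ) {a : ℝ} (ha : 0 < a) : 0 ≤ morreyConst n a := by
  unfold morreyConst; positivity

/-- Morrey's estimate for continuously differentiable functions. -/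
lemma dist_le_of_morreyBound {f : EuclideanSpace ℝ (Fin n) → ℝ} (hf : ContDiff ℝ 1 f)
    {K : ℝ≥0} {a : ℝ} (ha : 0 < a) (hK : MorreyBound (fun x => ‖fderiv ℝ f x‖ₑ) K a)
    (x y : EuclideanSpace ℝ (Fin n)) :
    dist (f x) (f y) ≤ morreyConst n a * K * dist x y ^ a := by
  rcases eq_or_ne x y with rfl | hxy
  · simp [Real.zero_rpow ha.ne']
  set R := dist x y with hRdef
  have hR : 0 < R := dist_pos.2 hxy
  -- The ball of radius `R/2` about the midpoint lies in both `B(x, R)` and `B(y, R)`. Averaging `|f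
  -- x - f y| ≤ |f w - f x| + |f w - f y|` over it gives the factor `2 · 2^n` of `morreyConst`.
  set m := midpoint ℝ x y
  have hmx : dist m x = R / 2 := by
    rw [dist_midpoint_left, Real.norm_ofNat]; ring
  have hmy : dist m y = R / 2 := by
    rw [dist_midpoint_right, Real.norm_ofNat]; ring
  have hsx : Metric.ball m (R / 2) ⊆ Metric.ball x R :=
    Metric.ball_subset_ball' (by rw [hmx]; linarith)
  have hsy : Metric.ball m (R / 2) ⊆ Metric.ball y R :=
    Metric.ball_subset_ball' (by rw [hmy]; linarith)
  have hfc := hf.continuous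
  set ω := (volume (Metric.ball (0 : EuclideanSpace ℝ (Fin n)) 1)).toReal with hω
  have hω0 : 0 < ω := ENNReal.toReal_pos (Metric.measure_ball_pos _ _ one_pos).ne'
    measure_ball_lt_top.ne
  have h1 : ENNReal.ofReal (dist (f x) (f y) * ((R / 2) ^ n * ω)) ≤
      ENNReal.ofReal (K * R ^ (n + a) / a + K * R ^ (n + a) / a) := by
    calc ENNReal.ofReal (dist (f x) (f y) * ((R / 2) ^ n * ω))
        = ∫⁻ w in Metric.ball m (R / 2), ‖f x - f y‖ₑ := by
          rw [setLIntegral_const, Measure.addHaar_ball_of_pos _ _ (by positivity),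
            ENNReal.ofReal_mul dist_nonneg, ENNReal.ofReal_mul (by positivity), hω,
            ENNReal.ofReal_toReal measure_ball_lt_top.ne, dist_eq_norm, ofReal_norm]
          simp
      _ ≤ ∫⁻ w in Metric.ball m (R / 2), (‖f w - f x‖ₑ + ‖f w - f y‖ₑ) := by
          refine lintegral_mono fun w => ?_
          rw [← enorm_neg (f w - f x)]
          refine le_trans (le_of_eq ?_) (enorm_add_le _ _)
          congr 1; ring
      _ = (∫⁻ w in Metric.ball m (R / 2), ‖f w - f x‖ₑ) +
          ∫⁻ w in Metric.ball m (R / 2), ‖f w - f y‖ₑ :=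
          lintegral_add_left (hfc.sub continuous_const).enorm.measurable _
      _ ≤ _ := by
          rw [ENNReal.ofReal_add (by positivity) (by positivity)]
          exact add_le_add
            ((lintegral_mono_set hsx).trans (lintegral_ball_enorm_sub_le hf ha hK x hR))
            ((lintegral_mono_set hsy).trans (lintegral_ball_enorm_sub_le hf ha hK y hR))
  rw [ENNReal.ofReal_le_ofReal_iff (by positivity), ← le_div_iff₀ (by positivity)] at h1
  refine h1.trans (le_of_eq ?_)
  rw [morreyConst, ← hω, Real.rpow_add hR, Real.rpow_natCast, div_pow]
  field_simp
  ring

end Morrey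

/-- A Hölder continuous function on a dense set extends to the whole space. -/
lemma exists_holderWith_eqOn {X : Type*} [MetricSpace X] {S : Set X} (hS : Dense S) {u : X → ℝ}
    {C a : ℝ≥0} (ha : 0 < a) (hu : HolderOnWith C a u S) :
    ∃ w : X → ℝ, HolderWith C a w ∧ EqOn w u S := by
  have huc : UniformContinuous (S.domRestrict u) := (HolderWith.restrict_iff.2 hu).uniformContinuous ha
  have hw : Continuous (hS.extend (S.domRestrict u)) := (hS.uniformContinuous_extend huc).continuous
  have heq : EqOn (hS.extend (S.domRestrict u)) u S := fun x hx =>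
    hS.extend_eq huc.continuous ⟨x, hx⟩
  refine ⟨hS.extend (S.domRestrict u), fun x y => ?_, heq⟩
  -- The Hölder inequality is a closed condition on the pair `(x, y)`, so it passes from the dense
  -- set to all pairs.
  refine isClosed_property2 (p := fun x y => edist (hS.extend (S.domRestrict u) x)
    (hS.extend (S.domRestrict u) y) ≤ C * edist x y ^ (a : ℝ)) hS.denseRange_val ?_ ?_ x y
  · refine isClosed_le ((hw.comp continuous_fst).edist (hw.comp continuous_snd)) ?_
    refine (ENNReal.continuous_const_mul ENNReal.coe_ne_top).comp ?_
    exact ENNReal.continuous_rpow_const.comp (continuous_fst.edist continuous_snd)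
  · intro x y
    rw [heq x.2, heq y.2]
    exact hu x x.2 y y.2

lemma holderOnWith_of_dist_le {X : Type*} [PseudoMetricSpace X] {S : Set X} {u : X → ℝ}
    {C a : ℝ≥0} (h : ∀ x ∈ S, ∀ y ∈ S, dist (u x) (u y) ≤ C * dist x y ^ (a : ℝ)) :
    HolderOnWith C a u S := fun x hx y hy => by
  rw [edist_dist, edist_dist, ENNReal.ofReal_rpow_of_nonneg dist_nonneg a.coe_nonneg,
    ← ENNReal.ofReal_coe_nnreal, ← ENNReal.ofReal_mul C.coe_nonneg]
  exact ENNReal.ofReal_le_ofReal (h x hx y hy)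

/-! ### Mollification and the Hölder version on the whole space -/

section Mollify
variable {n : ℕ}

lemma integrable_mul_of_locallyIntegrableOn {Ω : Set (EuclideanSpace ℝ (Fin n))}
    {g u : EuclideanSpace ℝ (Fin n) → ℝ} (hu : LocallyIntegrableOn u Ω) (hg : Continuous g)
    (hgc : HasCompactSupport g) (hgs : tsupport g ⊆ Ω) : Integrable (fun x => g x * u x) := by
  have h1 : IntegrableOn u (tsupport g) := hu.integrableOn_compact_subset hgs hgc
  have h2 := h1.continuousOn_mul hg.continuousOn hgc
  refine (integrableOn_iff_integrable_of_support_subset ?_).1 h2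
  intro x hx
  exact subset_tsupport _ (fun h => hx (by simp [h]))

lemma IsWeakGradient.aestronglyMeasurable {Ω : Set (EuclideanSpace ℝ (Fin n))}
    {u : EuclideanSpace ℝ (Fin n) → ℝ}
    {G : EuclideanSpace ℝ (Fin n) → EuclideanSpace ℝ (Fin n)} (h : IsWeakGradient Ω u G) :
    AEStronglyMeasurable G (volume.restrict Ω) := by
  have h1 : AEMeasurable (fun x i => G x i) (volume.restrict Ω) :=
    aemeasurable_pi_lambda _ fun i => (h i).2.1.aestronglyMeasurable.aemeasurable
  exact ((PiLp.continuous_toLp 2 _).measurable.comp_aemeasurable h1).aestronglyMeasurable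

/-- Linear combination of the coordinate identities. With an arbitrary direction `v`, Cauchy–Schwarz
later gives a bound by `|G|` without a factor depending on the dimension. -/
lemma IsWeakGradient.integral_fderiv_mul {Ω : Set (EuclideanSpace ℝ (Fin n))}
    {u : EuclideanSpace ℝ (Fin n) → ℝ}
    {G : EuclideanSpace ℝ (Fin n) → EuclideanSpace ℝ (Fin n)} (h : IsWeakGradient Ω u G)
    {φ : EuclideanSpace ℝ (Fin n) → ℝ} (hφ : IsTestFunction Ω φ)
    (v : EuclideanSpace ℝ (Fin n)) :
    ∫ x in Ω, fderiv ℝ φ x v * u x = -∫ x in Ω, φ x * inner ℝ v (G x) := by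
  have hsum : v = ∑ i, v i • EuclideanSpace.single i (1 : ℝ) := by
    simpa using ((EuclideanSpace.basisFun (Fin n) ℝ).sum_repr v).symm
  have h1 : ∀ x, fderiv ℝ φ x v * u x =
      ∑ i, v i * (fderiv ℝ φ x (EuclideanSpace.single i 1) * u x) := by
    intro x
    conv_lhs => rw [hsum]
    simp [Finset.sum_mul, mul_assoc]
  have h2 : ∀ x, φ x * inner ℝ v (G x) = ∑ i, v i * (φ x * G x i) := by
    intro x
    simp only [PiLp.inner_apply, Finset.mul_sum]
    refine Finset.sum_congr rfl fun i _ => ?_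
    simp; ring
  have hc : ∀ i : Fin n, Continuous fun x => fderiv ℝ φ x (EuclideanSpace.single i 1) := fun i =>
    (hφ.1.continuous_fderiv (by simp)).clm_apply continuous_const
  have hs : ∀ i : Fin n, Function.support (fun x => fderiv ℝ φ x (EuclideanSpace.single i 1)) ⊆
      tsupport φ := fun i x hx => support_fderiv_subset ℝ fun h => hx (by simp [h])
  simp_rw [h1, h2]
  rw [integral_finsetSum, integral_finsetSum, ← Finset.sum_neg_distrib]
  · refine Finset.sum_congr rfl fun i _ => ?_
    rw [integral_const_mul, integral_const_mul, (h i).2.2 φ hφ]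
    ring
  · intro i _
    exact ((integrable_mul_of_locallyIntegrableOn (h i).2.1 hφ.1.continuous hφ.2.1
      hφ.2.2).integrableOn).const_mul _
  · intro i _
    refine ((integrable_mul_of_locallyIntegrableOn (h i).1 (hc i) (hφ.2.1.mono' (hs i))
      ?_).integrableOn).const_mul _
    exact (closure_minimal (hs i) (isClosed_tsupport _)).trans hφ.2.2

-- The derivative falls on `φ`. Since `y ↦ φ(x - y)` is a test function, the weak gradient identity
-- moves it onto `u`, the two sign changes cancelling.
open scoped Convolution in
lemma enorm_fderiv_convolution_le {u : EuclideanSpace ℝ (Fin n) → ℝ}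
    {G : EuclideanSpace ℝ (Fin n) → EuclideanSpace ℝ (Fin n)} (h : IsWeakGradient univ u G)
    (hu : LocallyIntegrable u)
    {φ : EuclideanSpace ℝ (Fin n) → ℝ} (hφ : ContDiff ℝ (⊤ : ℕ∞) φ) (hφc : HasCompactSupport φ)
    (x : EuclideanSpace ℝ (Fin n)) :
    ‖fderiv ℝ (φ ⋆[ContinuousLinearMap.lsmul ℝ ℝ, volume] u) x‖ₑ ≤
      ∫⁻ y, ‖φ (x - y)‖ₑ * ‖G y‖ₑ := by
  have hφ1 : ContDiff ℝ 1 φ := hφ.of_le (by exact_mod_cast le_top)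
  refine ContinuousLinearMap.opENorm_le_bound _ fun v => ?_
  set ψ : EuclideanSpace ℝ (Fin n) → ℝ := fun y => φ (x - y) with hψ
  have hψt : IsTestFunction univ ψ :=
    ⟨hφ.comp (contDiff_const.sub contDiff_id),
      hφc.comp_homeomorph (Homeomorph.subLeft x), subset_univ _⟩
  have hψd : ∀ y, fderiv ℝ ψ y v = -fderiv ℝ φ (x - y) v := by
    intro y
    have h1 : HasFDerivAt ψ _ y := ((hφ1.differentiable one_ne_zero _).hasFDerivAt).comp y
      ((hasFDerivAt_id y).const_sub x)
    rw [h1.fderiv]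
    simp
  have h1 : fderiv ℝ (φ ⋆[ContinuousLinearMap.lsmul ℝ ℝ, volume] u) x v =
      ∫ y, ψ y * inner ℝ v (G y) := by
    rw [(hφc.hasFDerivAt_convolution_left _ hφ1 hu x).fderiv, convolution_def,
      ContinuousLinearMap.integral_apply]
    · have h2 := h.integral_fderiv_mul hψt v
      rw [setIntegral_univ, setIntegral_univ] at h2
      rw [← neg_eq_iff_eq_neg.2 h2, ← integral_neg,
        ← integral_sub_left_eq_self _ volume x]
      refine integral_congr_ae (Eventually.of_forall fun y => ?_)
      simp [hψd]
    · exact (hφc.fderiv (𝕜 := ℝ)).convolutionExists_left _ (hφ1.continuous_fderiv one_ne_zero) hu x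
  rw [h1, ← lintegral_mul_const' _ _ enorm_ne_top]
  refine (enorm_integral_le_lintegral_enorm _).trans (lintegral_mono fun y => ?_)
  rw [enorm_mul, mul_assoc]
  gcongr
  rw [mul_comm ‖G y‖ₑ]
  rw [← ofReal_norm, ← ofReal_norm, ← ofReal_norm, ← ENNReal.ofReal_mul (norm_nonneg _)]
  exact ENNReal.ofReal_le_ofReal (norm_inner_le_norm _ _)

-- The convolution averages translates of `|G|`, with weight `|φ|` of total mass at most 1. Each
-- translate satisfies the same bound because the centres of the balls are arbitrary, so Tonelli's
-- theorem preserves `K`.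
open scoped Convolution in
lemma morreyBound_fderiv_convolution {u : EuclideanSpace ℝ (Fin n) → ℝ}
    {G : EuclideanSpace ℝ (Fin n) → EuclideanSpace ℝ (Fin n)} (h : IsWeakGradient univ u G)
    (hu : LocallyIntegrable u) {K : ℝ≥0} {a : ℝ} (hG : MorreyBound (fun x => ‖G x‖ₑ) K a)
    {φ : EuclideanSpace ℝ (Fin n) → ℝ} (hφ : ContDiff ℝ (⊤ : ℕ∞) φ) (hφc : HasCompactSupport φ)
    (hφ1 : ∫⁻ x, ‖φ x‖ₑ ≤ 1) :
    MorreyBound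
      (fun x => ‖fderiv ℝ (φ ⋆[ContinuousLinearMap.lsmul ℝ ℝ, volume] u) x‖ₑ) K a := by
  intro z r hr
  have hGm : AEMeasurable (fun x => ‖G x‖ₑ) := by
    simpa using h.aestronglyMeasurable.enorm
  set g := hGm.mk with hg
  have hgm : Measurable g := hGm.measurable_mk
  have hGg : (fun x => ‖G x‖ₑ) =ᵐ[volume] g := hGm.ae_eq_mk
  have hφm : Measurable φ := hφ.continuous.measurable
  have h1 : ∀ x, ‖fderiv ℝ (φ ⋆[ContinuousLinearMap.lsmul ℝ ℝ, volume] u) x‖ₑ ≤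
      ∫⁻ t, ‖φ t‖ₑ * g (x - t) := by
    intro x
    refine (enorm_fderiv_convolution_le h hu hφ hφc x).trans (le_of_eq ?_)
    rw [← lintegral_sub_left_eq_self (fun t => ‖φ t‖ₑ * g (x - t)) x]
    refine lintegral_congr_ae ?_
    filter_upwards [hGg] with y hy
    rw [sub_sub_cancel, ← hy]
  have h2 : ∀ t, ∫⁻ x in Metric.ball z r, g (x - t) ≤ K * ENNReal.ofReal (r ^ (n - 1 + a)) := by
    intro t
    refine le_trans (le_of_eq ?_) (hG (z - t) r hr)
    rw [lintegral_congr_ae (ae_restrict_of_ae hGg),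
      ← lintegral_indicator Metric.isOpen_ball.measurableSet,
      ← lintegral_indicator Metric.isOpen_ball.measurableSet,
      ← lintegral_sub_right_eq_self ((Metric.ball (z - t) r).indicator g) t]
    refine lintegral_congr fun x => ?_
    have : x ∈ Metric.ball z r ↔ x - t ∈ Metric.ball (z - t) r := by
      simp [Metric.mem_ball, dist_eq_norm]
    by_cases hx : x ∈ Metric.ball z r
    · rw [indicator_of_mem hx, indicator_of_mem (this.1 hx)]
    · rw [indicator_of_notMem hx, indicator_of_notMem (this.not.1 hx)]
  calc _ ≤ ∫⁻ x in Metric.ball z r, ∫⁻ t, ‖φ t‖ₑ * g (x - t) := lintegral_mono h1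
    _ = ∫⁻ t, ∫⁻ x in Metric.ball z r, ‖φ t‖ₑ * g (x - t) := by
        refine lintegral_lintegral_swap (Measurable.aemeasurable ?_)
        exact (hφm.comp measurable_snd).enorm.mul
          (hgm.comp (measurable_fst.sub measurable_snd))
    _ = ∫⁻ t, ‖φ t‖ₑ * ∫⁻ x in Metric.ball z r, g (x - t) := by
        refine lintegral_congr fun t => lintegral_const_mul' _ _ enorm_ne_top
    _ ≤ ∫⁻ t, ‖φ t‖ₑ * (K * ENNReal.ofReal (r ^ (n - 1 + a))) :=
        lintegral_mono fun t => mul_le_mul_right (h2 t) _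
    _ ≤ _ := by
        rw [lintegral_mul_const _ hφm.enorm]
        exact mul_le_of_le_one_left' hφ1

open scoped Convolution in
/-- A function on the whole space whose weak gradient satisfies a Morrey condition has a Hölder
continuous version. -/
theorem exists_holderWith_of_morreyBound {u : EuclideanSpace ℝ (Fin n) → ℝ}
    {G : EuclideanSpace ℝ (Fin n) → EuclideanSpace ℝ (Fin n)} (h : IsWeakGradient univ u G)
    (hu : LocallyIntegrable u) {K a : ℝ≥0} (ha : 0 < a)
    (hG : MorreyBound (fun x => ‖G x‖ₑ) K a) :
    ∃ w : EuclideanSpace ℝ (Fin n) → ℝ,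
      HolderWith ((morreyConst n a).toNNReal * K) a w ∧ w =ᵐ[volume] u := by
  -- The ratio of outer to inner radius stays equal to 2. Almost everywhere convergence of the
  -- mollifications requires a bounded ratio.
  let φ : ℕ → ContDiffBump (0 : EuclideanSpace ℝ (Fin n)) := fun k =>
    ⟨1 / (k + 1), 2 / (k + 1), by positivity, by gcongr; norm_num⟩
  have hφ0 : Tendsto (fun k => (φ k).rOut) atTop (𝓝 0) := by
    have := (tendsto_one_div_add_atTop_nhds_zero_nat (𝕜 := ℝ)).const_mul 2
    simpa only [φ, mul_one_div, mul_zero] using this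
  have hlim := ContDiffBump.ae_convolution_tendsto_right_of_locallyIntegrable (μ := volume)
    (K := 2) hφ0 (Eventually.of_forall fun k => le_of_eq (by simp [φ]; ring)) hu
  -- `S` has full measure and is therefore dense. On it the estimates, uniform in `k`, pass to the
  -- limit for the values of `u` itself.
  set S := {x | Tendsto (fun k => ((φ k).normed volume ⋆[ContinuousLinearMap.lsmul ℝ ℝ, volume] u) x)
    atTop (𝓝 (u x))} with hS
  have hSd : Dense S := Measure.dense_of_ae hlim
  have hest : ∀ k x y, dist
      (((φ k).normed volume ⋆[ContinuousLinearMap.lsmul ℝ ℝ, volume] u) x)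
      (((φ k).normed volume ⋆[ContinuousLinearMap.lsmul ℝ ℝ, volume] u) y) ≤
      morreyConst n a * K * dist x y ^ (a : ℝ) := by
    intro k x y
    have hc : HasCompactSupport ((φ k).normed volume) := (φ k).hasCompactSupport_normed
    refine dist_le_of_morreyBound (hc.contDiff_convolution_left (n := 1) _ (φ k).contDiff_normed hu)
      (by exact_mod_cast ha)
      (morreyBound_fderiv_convolution h hu hG (φ k).contDiff_normed hc (le_of_eq ?_)) x y
    have h1 : ∀ x, ‖(φ k).normed volume x‖ₑ = ENNReal.ofReal ((φ k).normed volume x) := fun x =>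
      Real.enorm_of_nonneg ((φ k).nonneg_normed x)
    simp_rw [h1]
    rw [← ofReal_integral_eq_lintegral_ofReal (φ k).integrable_normed
      (Eventually.of_forall (φ k).nonneg_normed), (φ k).integral_normed, ENNReal.ofReal_one]
  have hhol : HolderOnWith ((morreyConst n a).toNNReal * K) a u S := by
    refine holderOnWith_of_dist_le fun x hx y hy => ?_
    rw [NNReal.coe_mul, Real.coe_toNNReal _ (morreyConst_nonneg n (by exact_mod_cast ha))]
    exact le_of_tendsto (Tendsto.dist hx hy) (Eventually.of_forall fun k => hest k x y)
  obtain ⟨w, hw, hwS⟩ := exists_holderWith_eqOn hSd ha hhol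
  exact ⟨w, hw, by filter_upwards [hlim] with x hx using hwS hx⟩

end Mollify

/-! ### Test functions, cutoffs and the calculus of weak gradients -/

section Test
variable {n : ℕ} {Ω : Set (EuclideanSpace ℝ (Fin n))}

lemma IsTestFunction.fderiv_apply {φ : EuclideanSpace ℝ (Fin n) → ℝ} (hφ : IsTestFunction Ω φ)
    (v : EuclideanSpace ℝ (Fin n)) : IsTestFunction Ω (fun x => fderiv ℝ φ x v) := by
  have hs : Function.support (fun x => fderiv ℝ φ x v) ⊆ tsupport φ := fun x hx =>
    support_fderiv_subset ℝ fun h => hx (by simp [h])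
  exact ⟨(hφ.1.fderiv_right (m := (⊤ : ℕ∞)) (by simp)).clm_apply contDiff_const,
    hφ.2.1.mono' hs, (closure_minimal hs (isClosed_tsupport _)).trans hφ.2.2⟩

lemma IsTestFunction.mul {η φ : EuclideanSpace ℝ (Fin n) → ℝ} (hη : IsTestFunction Ω η)
    (hφ : ContDiff ℝ (⊤ : ℕ∞) φ) : IsTestFunction Ω (fun x => φ x * η x) :=
  ⟨hφ.mul hη.1, hη.2.1.mul_left, (tsupport_mul_subset_right).trans hη.2.2⟩

lemma IsTestFunction.integrable_mul {φ u : EuclideanSpace ℝ (Fin n) → ℝ} (hφ : IsTestFunction Ω φ)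
    (hu : LocallyIntegrableOn u Ω) : Integrable (fun x => φ x * u x) :=
  integrable_mul_of_locallyIntegrableOn hu hφ.1.continuous hφ.2.1 hφ.2.2

lemma IsTestFunction.eq_zero {φ : EuclideanSpace ℝ (Fin n) → ℝ} (hφ : IsTestFunction Ω φ)
    {x : EuclideanSpace ℝ (Fin n)} (hx : x ∉ Ω) : φ x = 0 :=
  image_eq_zero_of_notMem_tsupport fun h => hx (hφ.2.2 h)

lemma IsTestFunction.setIntegral_mul {φ : EuclideanSpace ℝ (Fin n) → ℝ} (hφ : IsTestFunction Ω φ)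
    (u : EuclideanSpace ℝ (Fin n) → ℝ) : ∫ x in Ω, φ x * u x = ∫ x, φ x * u x :=
  setIntegral_eq_integral_of_forall_compl_eq_zero fun x hx => by simp [hφ.eq_zero hx]

lemma gradient_apply (η : EuclideanSpace ℝ (Fin n) → ℝ) (x : EuclideanSpace ℝ (Fin n))
    (i : Fin n) : gradient η x i = fderiv ℝ η x (EuclideanSpace.single i 1) := by
  rw [← inner_gradient_left, EuclideanSpace.inner_single_right]
  simp

lemma enorm_gradient (η : EuclideanSpace ℝ (Fin n) → ℝ) (x : EuclideanSpace ℝ (Fin n)) :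
    ‖gradient η x‖ₑ = ‖fderiv ℝ η x‖ₑ := by
  simp only [gradient, ← ofReal_norm, LinearIsometryEquiv.norm_map]

lemma IsTestFunction.gradient_eq_zero {φ : EuclideanSpace ℝ (Fin n) → ℝ}
    (hφ : IsTestFunction Ω φ) {x : EuclideanSpace ℝ (Fin n)} (hx : x ∉ Ω) : gradient φ x = 0 := by
  ext i
  rw [gradient_apply]
  exact (hφ.fderiv_apply _).eq_zero hx

lemma IsTestFunction.exists_enorm_gradient_le {φ : EuclideanSpace ℝ (Fin n) → ℝ}
    (hφ : IsTestFunction Ω φ) : ∃ c : ℝ≥0, ∀ x, ‖gradient φ x‖ₑ ≤ c := by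
  have hc : Continuous (fderiv ℝ φ) := hφ.1.continuous_fderiv (by simp)
  obtain ⟨c, hc⟩ := hc.bounded_above_of_compact_support (hφ.2.1.fderiv (𝕜 := ℝ))
  refine ⟨c.toNNReal, fun x => ?_⟩
  rw [enorm_gradient, ← ofReal_norm]
  exact ENNReal.ofReal_le_ofReal (hc x)

lemma IsTestFunction.exists_enorm_le {φ : EuclideanSpace ℝ (Fin n) → ℝ}
    (hφ : IsTestFunction Ω φ) : ∃ c : ℝ≥0, ∀ x, ‖φ x‖ₑ ≤ c := by
  obtain ⟨c, hc⟩ := hφ.1.continuous.bounded_above_of_compact_support hφ.2.1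
  refine ⟨c.toNNReal, fun x => ?_⟩
  rw [← ofReal_norm]
  exact ENNReal.ofReal_le_ofReal (hc x)

/-- Smooth cutoff functions. -/
lemma exists_cutoff {K : Set (EuclideanSpace ℝ (Fin n))} (hK : IsCompact K) (hΩ : IsOpen Ω)
    (hKΩ : K ⊆ Ω) :
    ∃ (η : EuclideanSpace ℝ (Fin n) → ℝ) (U : Set (EuclideanSpace ℝ (Fin n))),
      IsTestFunction Ω η ∧ (∀ x, ‖η x‖ₑ ≤ 1) ∧ IsOpen U ∧ K ⊆ U ∧ ∀ x ∈ U, η x = 1 := by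
  obtain ⟨V, hV, hKV, hVΩ, hVc⟩ := exists_open_between_and_isCompact_closure hK hΩ hKΩ
  obtain ⟨f, hf1, hf0, hf⟩ := exists_contMDiffMap_one_nhds_of_subset_interior
    (n := (⊤ : ℕ∞)) (modelWithCornersSelf ℝ (EuclideanSpace ℝ (Fin n))) hK.isClosed
    (hKV.trans hV.interior_eq.symm.subset)
  have hs : tsupport f ⊆ closure V := closure_mono fun x hx => by
    by_contra h
    exact hx (hf0 x h)
  obtain ⟨U, hU, hKU, hU1⟩ := eventually_nhdsSet_iff_exists.1 hf1
  refine ⟨f, U, ⟨f.contMDiff.contDiff, hVc.of_isClosed_subset (isClosed_tsupport _) hs,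
    hs.trans hVΩ⟩, fun x => ?_, hU, hKU, hU1⟩
  rw [Real.enorm_of_nonneg (hf x).1]
  simpa using (hf x).2

/-- The product of a weakly differentiable function with a cutoff function, on the whole space. -/
lemma IsWeakPartial.testFunction_mul {u v η : EuclideanSpace ℝ (Fin n) → ℝ} {i : Fin n}
    (h : IsWeakPartial Ω u i v) (hη : IsTestFunction Ω η) :
    IsWeakPartial univ (fun x => η x * u x) i
      (fun x => η x * v x + fderiv ℝ η x (EuclideanSpace.single i 1) * u x) := by
  set e : EuclideanSpace ℝ (Fin n) := EuclideanSpace.single i 1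
  have hη' := hη.fderiv_apply e
  refine ⟨((hη.integrable_mul h.1).locallyIntegrable).locallyIntegrableOn _,
    (((hη.integrable_mul h.2.1).add (hη'.integrable_mul h.1)).locallyIntegrable).locallyIntegrableOn _,
    fun φ hφ => ?_⟩
  rw [setIntegral_univ, setIntegral_univ]
  have hφη := hη.mul hφ.1
  have hφη' := hη'.mul hφ.1
  have hφ'η := hη.mul (hφ.fderiv_apply e).1
  -- Testing the derivative of `u` in `Ω` against `φ η` makes `φ` an arbitrary test function on the
  -- whole space.
  have h1 := h.2.2 _ hφη
  rw [hφη.setIntegral_mul, (hφη.fderiv_apply e).setIntegral_mul] at h1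
  have h2 : ∀ x, fderiv ℝ (fun x => φ x * η x) x e * u x =
      φ x * fderiv ℝ η x e * u x + fderiv ℝ φ x e * η x * u x := by
    intro x
    rw [fderiv_fun_mul (hφ.1.differentiable (by simp) x) (hη.1.differentiable (by simp) x)]
    simp
    ring
  simp_rw [h2] at h1
  rw [integral_add (hφη'.integrable_mul h.1) (hφ'η.integrable_mul h.1)] at h1
  have h3 : ∀ x, φ x * (η x * v x + fderiv ℝ η x e * u x) =
      φ x * η x * v x + φ x * fderiv ℝ η x e * u x := fun x => by ring
  simp_rw [h3, ← mul_assoc]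
  rw [integral_add (hφη.integrable_mul h.2.1) (hφη'.integrable_mul h.1), h1]
  ring

lemma IsWeakGradient.testFunction_smul {u η : EuclideanSpace ℝ (Fin n) → ℝ}
    {G : EuclideanSpace ℝ (Fin n) → EuclideanSpace ℝ (Fin n)}
    (h : IsWeakGradient Ω u G) (hη : IsTestFunction Ω η) :
    IsWeakGradient univ (fun x => η x * u x) (fun x => η x • G x + u x • gradient η x) := by
  intro i
  have : (fun x => (η x • G x + u x • gradient η x) i) =
      fun x => η x * G x i + fderiv ℝ η x (EuclideanSpace.single i 1) * u x := by
    funext x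
    simp [gradient_apply, mul_comm]
  rw [this]
  exact (h i).testFunction_mul hη

lemma IsWeakGradient.restrict {u : EuclideanSpace ℝ (Fin n) → ℝ}
    {G : EuclideanSpace ℝ (Fin n) → EuclideanSpace ℝ (Fin n)} (hΩ : MeasurableSet Ω)
    (h : IsWeakGradient univ (Ω.indicator u) (Ω.indicator G)) : IsWeakGradient Ω u G := by
  intro i
  have h1 : (fun x => Ω.indicator G x i) =ᵐ[volume.restrict Ω] fun x => G x i := by
    filter_upwards [self_mem_ae_restrict hΩ] with x hx
    rw [indicator_of_mem hx]
  have h2 : Ω.indicator u =ᵐ[volume.restrict Ω] u := indicator_ae_eq_restrict hΩ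
  refine ⟨((h i).1.mono_set (subset_univ _)).congr h2, ((h i).2.1.mono_set (subset_univ _)).congr h1,
    fun φ hφ => ?_⟩
  have h3 := (h i).2.2 φ ⟨hφ.1, hφ.2.1, subset_univ _⟩
  rw [setIntegral_univ, setIntegral_univ, ← hφ.setIntegral_mul,
    ← (hφ.fderiv_apply _).setIntegral_mul] at h3
  rw [setIntegral_congr_ae hΩ (g := fun x => φ x * Ω.indicator G x i), h3]
  · congr 1
    refine integral_congr_ae ?_
    filter_upwards [h2] with x hx
    rw [hx]
  · exact Eventually.of_forall fun x hx => by rw [indicator_of_mem hx]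

/-- Weak gradients are unique up to null sets. -/
lemma IsWeakGradient.ae_eq {u : EuclideanSpace ℝ (Fin n) → ℝ}
    {G H : EuclideanSpace ℝ (Fin n) → EuclideanSpace ℝ (Fin n)} (hΩ : IsOpen Ω)
    (hG : IsWeakGradient Ω u G) (hH : IsWeakGradient Ω u H) : G =ᵐ[volume.restrict Ω] H := by
  have h1 : ∀ i, ∀ᵐ x, x ∈ Ω → G x i - H x i = 0 := by
    intro i
    refine hΩ.ae_eq_zero_of_integral_contDiff_smul_eq_zero ((hG i).2.1.sub (hH i).2.1)
      fun φ h1 h2 h3 => ?_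
    have hφ : IsTestFunction Ω φ := ⟨h1, h2, h3⟩
    have e1 := (hG i).2.2 φ hφ
    rw [← (hH i).2.2 φ hφ, hφ.setIntegral_mul, hφ.setIntegral_mul] at e1
    simp only [smul_eq_mul, mul_sub]
    rw [integral_sub (hφ.integrable_mul (hG i).2.1) (hφ.integrable_mul (hH i).2.1), e1, sub_self]
  rw [EventuallyEq, ae_restrict_iff' hΩ.measurableSet]
  filter_upwards [ae_all_iff.2 h1] with x hx hxΩ
  ext i
  exact sub_eq_zero.1 (hx i hxΩ)

end Test

lemma lorentzQuasinorm_congr_ae {α F : Type*} [MeasurableSpace α] [NormedAddCommGroup F]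
    {f g : α → F} {μ : Measure α} (h : f =ᵐ[μ] g) (p : ℝ) (q : ℝ≥0∞) :
    lorentzQuasinorm f p q μ = lorentzQuasinorm g p q μ := by
  have h1 : distribFn f μ = distribFn g μ := by
    funext v
    refine measure_congr ?_
    filter_upwards [h] with x hx
    exact propext (by change v < ‖f x‖ₑ ↔ v < ‖g x‖ₑ; rw [hx])
  unfold lorentzQuasinorm
  congr 1
  funext t
  rw [rearr, rearr, h1]

/-! ### From Lorentz quasinorms to Morrey bounds -/

section LorentzMorrey
variable {n : ℕ} {F : Type*} [NormedAddCommGroup F]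

/-- The constant in the Morrey bound for functions in Lorentz spaces. -/
noncomputable def lorentzMorreyConst (n : ℕ) (p : ℝ) (q : ℝ≥0∞) : ℝ≥0 :=
  (p / (p - 1)).toNNReal * weakConst p q *
    (volume (Metric.ball (0 : EuclideanSpace ℝ (Fin n)) 1)).toNNReal ^ (1 - 1 / p)

/-- Functions in `L^{p,q}` satisfy a Morrey bound. -/
lemma morreyBound_of_lorentzQuasinorm_le {Ω : Set (EuclideanSpace ℝ (Fin n))}
    (hΩ : MeasurableSet Ω) {f : EuclideanSpace ℝ (Fin n) → F}
    (hf : AEStronglyMeasurable f (volume.restrict Ω)) {p : ℝ} {q : ℝ≥0∞} (hp : 1 < p) (hq : 1 ≤ q)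
    {M : ℝ≥0} (hM : lorentzQuasinorm f p q (volume.restrict Ω) ≤ M) :
    MorreyBound (fun x => ‖Ω.indicator f x‖ₑ) (lorentzMorreyConst n p q * M) (1 - n / p) := by
  intro x r hr
  have hp0 : 0 < p := by linarith
  set ω := (volume (Metric.ball (0 : EuclideanSpace ℝ (Fin n)) 1)).toNNReal with hω
  have hω' : (ω : ℝ≥0∞) = volume (Metric.ball (0 : EuclideanSpace ℝ (Fin n)) 1) :=
    ENNReal.coe_toNNReal measure_ball_lt_top.ne
  have hω0 : 0 < ω := by
    have := Metric.measure_ball_pos volume (0 : EuclideanSpace ℝ (Fin n)) one_pos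
    rw [← hω'] at this
    exact_mod_cast this
  lift r to ℝ≥0 using hr.le
  have hr' : 0 < r := by exact_mod_cast hr
  have h1 : ∫⁻ y in Metric.ball x r, ‖Ω.indicator f y‖ₑ =
      ∫⁻ y in Metric.ball x r, ‖f y‖ₑ ∂(volume.restrict Ω) := by
    simp_rw [enorm_indicator_eq_indicator_enorm]
    rw [lintegral_indicator hΩ, Measure.restrict_comm hΩ]
  rw [h1]
  have h2 : (volume.restrict Ω) (Metric.ball x r) ≤ ((r ^ n * ω : ℝ≥0) : ℝ≥0∞) := by
    refine (Measure.restrict_apply_le _ _).trans (le_of_eq ?_)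
    rw [Measure.addHaar_ball_of_pos _ _ hr, ENNReal.coe_mul, hω']
    simp [ENNReal.ofReal_pow]
  refine (setLIntegral_le_of_weak hf hp (B := weakConst p q * M) (fun v => ?_) h2
    (by positivity)).trans (le_of_eq ?_)
  · refine (mul_distribFn_rpow_le f hp0 hq _ v).trans ?_
    rw [ENNReal.coe_mul]
    exact mul_le_mul_right hM _
  · have h3 : (0 : ℝ) ≤ 1 - 1 / p := by
      rw [sub_nonneg, div_le_one hp0]; exact hp.le
    -- The exponent identity `n(1 - 1/p) = n - 1 + (1 - n/p)`, which fixes the Hölder exponent.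
    have h4 : ENNReal.ofReal ((r : ℝ) ^ ((n : ℝ) - 1 + (1 - n / p))) =
        (((r ^ n) ^ (1 - 1 / p) : ℝ≥0) : ℝ≥0∞) := by
      rw [← ENNReal.ofReal_coe_nnreal, NNReal.coe_rpow, NNReal.coe_pow, ← Real.rpow_natCast,
        ← Real.rpow_mul r.coe_nonneg]
      congr 2
      field_simp
      ring
    rw [h4, ← ENNReal.coe_rpow_of_nonneg _ h3, NNReal.mul_rpow, lorentzMorreyConst, ENNReal.ofReal]
    norm_cast
    ring

lemma locallyIntegrable_of_morreyBound {f : EuclideanSpace ℝ (Fin n) → F}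
    (hf : AEStronglyMeasurable f) {K : ℝ≥0} {a : ℝ} (h : MorreyBound (fun x => ‖f x‖ₑ) K a) :
    LocallyIntegrable f := fun x =>
  ⟨Metric.ball x 1, Metric.ball_mem_nhds x one_pos, hf.restrict,
    (h x 1 one_pos).trans_lt (ENNReal.mul_lt_top ENNReal.coe_lt_top ENNReal.ofReal_lt_top)⟩

end LorentzMorrey

/-! ### Reduction of the assertions to the whole space -/

section Final
variable {n : ℕ} {Ω : Set (EuclideanSpace ℝ (Fin n))} {p : ℝ} {q : ℝ≥0∞}

lemma holderSeminorm_le {w : EuclideanSpace ℝ (Fin n) → ℝ} {C a : ℝ≥0} (hw : HolderWith C a w)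
    (D : Set (EuclideanSpace ℝ (Fin n))) : holderSeminorm a D w ≤ C := by
  refine iSup₂_le fun x _ => iSup₂_le fun y _ => iSup_le fun _ => ?_
  refine ENNReal.div_le_of_le_mul ?_
  simpa [edist_eq_enorm_sub] using hw x y

lemma memHolderClosure_of_holderWith {w : EuclideanSpace ℝ (Fin n) → ℝ} {C a : ℝ≥0} (ha : 0 < a)
    (hw : HolderWith C a w) : MemHolderClosure a Ω w :=
  ⟨(hw.continuous ha).continuousOn, (holderSeminorm_le hw Ω).trans_lt ENNReal.coe_lt_top⟩

lemma holderSeminorm_congr {w v : EuclideanSpace ℝ (Fin n) → ℝ} {a : ℝ}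
    {D : Set (EuclideanSpace ℝ (Fin n))} (h : EqOn w v D) :
    holderSeminorm a D w = holderSeminorm a D v := by
  refine iSup_congr fun x => iSup_congr fun hx => iSup_congr fun y => iSup_congr fun hy => ?_
  rw [h hx, h hy]

lemma enorm_le_sum_enorm (x : EuclideanSpace ℝ (Fin n)) : ‖x‖ₑ ≤ ∑ i, ‖x i‖ₑ := by
  have hsum : x = ∑ i, x i • EuclideanSpace.single i (1 : ℝ) := by
    simpa using ((EuclideanSpace.basisFun (Fin n) ℝ).sum_repr x).symm
  conv_lhs => rw [hsum]
  refine (enorm_sum_le _ _).trans (Finset.sum_le_sum fun i _ => ?_)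
  rw [enorm_smul, ← ofReal_norm (EuclideanSpace.single i (1 : ℝ))]
  simp

lemma MemLorentz.exists_morreyBound {F : Type*} [NormedAddCommGroup F] (hΩ : MeasurableSet Ω)
    {f : EuclideanSpace ℝ (Fin n) → F} (hf : MemLorentz f p q (volume.restrict Ω)) (hp : 1 < p)
    (hq : 1 ≤ q) : ∃ K, MorreyBound (fun x => ‖Ω.indicator f x‖ₑ) K (1 - n / p) := by
  have h1 : lorentzQuasinorm f p q (volume.restrict Ω) < ∞ :=
    (lorentzQuasinorm_le_lorentzNorm _ _ _ _).trans_lt hf.2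
  exact ⟨_, morreyBound_of_lorentzQuasinorm_le hΩ hf.1 hp hq (ENNReal.coe_toNNReal h1.ne).ge⟩

/-- Morrey bounds add, so passing from the components to `|G|` needs no triangle inequality in the
Lorentz space. -/
lemma exists_morreyBound_of_components (hΩ : MeasurableSet Ω)
    {G : EuclideanSpace ℝ (Fin n) → EuclideanSpace ℝ (Fin n)}
    (hG : ∀ i, MemLorentz (fun x => G x i) p q (volume.restrict Ω)) (hp : 1 < p) (hq : 1 ≤ q) :
    ∃ K, MorreyBound (fun x => ‖Ω.indicator G x‖ₑ) K (1 - n / p) := by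
  choose K hK using fun i => (hG i).exists_morreyBound hΩ hp hq
  refine ⟨∑ i, K i, fun x r hr => ?_⟩
  have hm : ∀ i, AEMeasurable (fun y => ‖Ω.indicator (fun x => G x i) y‖ₑ) := fun i =>
    ((aestronglyMeasurable_indicator_iff hΩ).2 (hG i).1).enorm
  calc ∫⁻ y in Metric.ball x r, ‖Ω.indicator G y‖ₑ
      ≤ ∫⁻ y in Metric.ball x r, ∑ i, ‖Ω.indicator (fun x => G x i) y‖ₑ := by
        refine lintegral_mono fun y => ?_
        by_cases hy : y ∈ Ω
        · simp only [indicator_of_mem hy]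
          exact enorm_le_sum_enorm _
        · simp [indicator_of_notMem hy]
    _ = ∑ i, ∫⁻ y in Metric.ball x r, ‖Ω.indicator (fun x => G x i) y‖ₑ :=
        lintegral_finsetSum' _ fun i _ => (hm i).restrict
    _ ≤ ∑ i, K i * ENNReal.ofReal (r ^ (n - 1 + (1 - n / p))) :=
        Finset.sum_le_sum fun i _ => hK i x r hr
    _ = _ := by rw [← Finset.sum_mul, ENNReal.ofNNReal_finsetSum]

/-- Local integrability is recorded in each weak partial derivative, so one coordinate must exist.
-/
lemma IsWeakGradient.locallyIntegrable {u : EuclideanSpace ℝ (Fin n) → ℝ}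
    {G : EuclideanSpace ℝ (Fin n) → EuclideanSpace ℝ (Fin n)} (h : IsWeakGradient univ u G)
    (hn : 0 < n) : LocallyIntegrable u :=
  locallyIntegrableOn_univ.1 (h ⟨0, hn⟩).1

/-- Compactly supported functions: a Hölder continuous version on the whole space. -/
lemma exists_holderWith_of_compactlySupported (hn : 0 < n) (hΩ : IsOpen Ω) {a : ℝ≥0} (ha : 0 < a)
    {u : EuclideanSpace ℝ (Fin n) → ℝ}
    (hu : CompactlySupportedIn Ω u) :
    ∃ v : EuclideanSpace ℝ (Fin n) → ℝ, v =ᵐ[volume.restrict Ω] u ∧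
      ∀ (G : EuclideanSpace ℝ (Fin n) → EuclideanSpace ℝ (Fin n)) (K : ℝ≥0),
        IsWeakGradient Ω u G → MorreyBound (fun x => ‖Ω.indicator G x‖ₑ) K a →
        ∃ w, HolderWith ((morreyConst n a).toNNReal * K) a w ∧ w =ᵐ[volume] v := by
  obtain ⟨K, hK, hKΩ, hu0⟩ := hu
  obtain ⟨η, U, hη, hη1, hU, hKU, hηU⟩ := exists_cutoff hK hΩ hKΩ
  -- The function `η u` is chosen before `G`. Hence the versions obtained from different weak
  -- gradients agree almost everywhere.
  refine ⟨fun x => η x * u x, ?_, fun G M hG hM => ?_⟩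
  · filter_upwards [hu0] with x hx
    by_cases hxK : x ∈ K
    · rw [hηU x (hKU hxK), one_mul]
    · rw [hx hxK, mul_zero]
  · have hG' := hG.testFunction_smul hη
    refine exists_holderWith_of_morreyBound hG' (hG'.locallyIntegrable hn) ha (hM.mono ?_)
    have h1 : ∀ᵐ x, x ∈ Ω → x ∉ K → u x = 0 := (ae_restrict_iff' hΩ.measurableSet).1 hu0
    filter_upwards [h1] with x hx
    by_cases hxΩ : x ∈ Ω
    · have h2 : u x • gradient η x = 0 := by
        by_cases hxK : x ∈ K
        · have : η =ᶠ[𝓝 x] fun _ => 1 := by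
            filter_upwards [hU.mem_nhds (hKU hxK)] with y hy using hηU y hy
          rw [this.gradient_eq, gradient_fun_const, smul_zero]
        · rw [hx hxΩ hxK, zero_smul]
      rw [h2, add_zero, indicator_of_mem hxΩ, enorm_smul]
      exact mul_le_of_le_one_left' (hη1 x)
    · simp [hη.eq_zero hxΩ, hη.gradient_eq_zero hxΩ]

/-- Functions with local representatives that are continuous near every compact set have one
version which agrees with all of them. -/
lemma exists_version_eqOn (hΩ : IsOpen Ω) (u : EuclideanSpace ℝ (Fin n) → ℝ)
    (h : ∀ x ∈ Ω, ∃ (U : Set (EuclideanSpace ℝ (Fin n))) (v : EuclideanSpace ℝ (Fin n) → ℝ),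
      IsOpen U ∧ x ∈ U ∧ Continuous v ∧ v =ᵐ[volume.restrict U] u) :
    ∃ w : EuclideanSpace ℝ (Fin n) → ℝ, IsVersion Ω w u ∧
      ∀ (U : Set (EuclideanSpace ℝ (Fin n))) (v : EuclideanSpace ℝ (Fin n) → ℝ), IsOpen U →
        Continuous v → v =ᵐ[volume.restrict U] u → EqOn w v (Ω ∩ U) := by
  choose! U v hU hxU hv hvu using h
  -- Continuous functions that agree almost everywhere on an open set agree there everywhere. The
  -- diagonal choice `v x x` therefore coincides with every continuous local representative.
  have key : ∀ (V : Set (EuclideanSpace ℝ (Fin n))) (v' : EuclideanSpace ℝ (Fin n) → ℝ), IsOpen V →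
      Continuous v' → v' =ᵐ[volume.restrict V] u → EqOn (fun x => v x x) v' (Ω ∩ V) := by
    intro V v' hV hv' hv'u x hx
    have h1 : v x =ᵐ[volume.restrict (U x ∩ V)] u :=
      ae_restrict_of_ae_restrict_of_subset inter_subset_left (hvu x hx.1)
    have h2 : v' =ᵐ[volume.restrict (U x ∩ V)] u :=
      ae_restrict_of_ae_restrict_of_subset inter_subset_right hv'u
    exact Measure.eqOn_open_of_ae_eq (h1.trans h2.symm) ((hU x hx.1).inter hV)
      (hv x hx.1).continuousOn hv'.continuousOn ⟨hxU x hx.1, hx.2⟩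
  refine ⟨fun x => v x x, ?_, key⟩
  have h0 : volume {x | ¬ (x ∈ Ω → v x x = u x)} = 0 := by
    refine measure_null_of_locally_null _ fun x hx => ?_
    have hxΩ : x ∈ Ω := by
      by_contra h
      exact hx fun h' => absurd h' h
    refine ⟨U x ∩ {x | ¬ (x ∈ Ω → v x x = u x)},
      inter_mem (mem_nhdsWithin_of_mem_nhds ((hU x hxΩ).mem_nhds (hxU x hxΩ)))
        self_mem_nhdsWithin, ?_⟩
    have h1 := (ae_restrict_iff' (hU x hxΩ).measurableSet).1 (hvu x hxΩ)
    refine measure_mono_null (fun y hy => ?_) (ae_iff.1 h1)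
    refine fun h2 => hy.2 fun hyΩ => ?_
    rw [← h2 hy.1]
    exact key (U x) (v x) (hU x hxΩ) (hv x hxΩ) (hvu x hxΩ) ⟨hyΩ, hy.1⟩
  exact (ae_restrict_iff' hΩ.measurableSet).2 h0

/-- Local Hölder regularity near compact sets. -/
lemma exists_holderWith_nhds_of_memW1 (hn : 0 < n) (hp1 : 1 < p) (hq : 1 ≤ q)
    {a : ℝ≥0} (ha : (a : ℝ) = 1 - n / p) (ha0 : 0 < a)
    (hΩ : IsOpen Ω) {u : EuclideanSpace ℝ (Fin n) → ℝ} (hu : MemW1 Ω p q u)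
    {K : Set (EuclideanSpace ℝ (Fin n))} (hK : IsCompact K) (hKΩ : K ⊆ Ω) :
    ∃ (U : Set (EuclideanSpace ℝ (Fin n))) (v : EuclideanSpace ℝ (Fin n) → ℝ) (C : ℝ≥0),
      IsOpen U ∧ K ⊆ U ∧ HolderWith C a v ∧ v =ᵐ[volume.restrict U] u := by
  obtain ⟨hu, G, hG, hGi⟩ := hu
  obtain ⟨η, U, hη, hη1, hU, hKU, hηU⟩ := exists_cutoff hK hΩ hKΩ
  obtain ⟨c, hc⟩ := hη.exists_enorm_gradient_le
  obtain ⟨K₁, hK₁⟩ := exists_morreyBound_of_components hΩ.measurableSet hGi hp1 hq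
  -- The bound for `u` controls the term `u ∇η` of the product rule, `∇η` being bounded.
  obtain ⟨K₂, hK₂⟩ := hu.exists_morreyBound hΩ.measurableSet hp1 hq
  rw [← ha] at hK₁ hK₂
  have hm : AEMeasurable fun x => ‖Ω.indicator G x‖ₑ :=
    ((aestronglyMeasurable_indicator_iff hΩ.measurableSet).2 hG.aestronglyMeasurable).enorm
  have hG' := hG.testFunction_smul hη
  obtain ⟨v, hv, hvu⟩ := exists_holderWith_of_morreyBound hG' (hG'.locallyIntegrable hn) ha0
    ((hK₁.add (hK₂.const_mul c) hm).mono (Eventually.of_forall fun x => by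
      by_cases hxΩ : x ∈ Ω
      · simp only [indicator_of_mem hxΩ]
        refine (enorm_add_le _ _).trans ?_
        rw [enorm_smul, enorm_smul, mul_comm ‖u x‖ₑ]
        exact add_le_add (mul_le_of_le_one_left' (hη1 x)) (mul_le_mul_left (hc x) _)
      · simp [hη.eq_zero hxΩ, hη.gradient_eq_zero hxΩ]))
  refine ⟨U, v, _, hU, hKU, hv, ?_⟩
  filter_upwards [ae_restrict_of_ae hvu, self_mem_ae_restrict hU.measurableSet] with x hx hxU
  rw [hx, hηU x hxU, one_mul]

lemma weightedSum_lt {A B ε : ℝ≥0∞} {r : ℝ} (hr : 0 < r)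
    (h : (A ^ r + B ^ r) ^ (1 / r) < ε) : A < ε ∧ B < ε := by
  have h1 : ∀ X : ℝ≥0∞, X = (X ^ r) ^ (1 / r) := fun X => by
    rw [← ENNReal.rpow_mul, mul_one_div_cancel hr.ne', ENNReal.rpow_one]
  constructor
  · refine lt_of_le_of_lt ?_ h
    conv_lhs => rw [h1 A]
    exact ENNReal.rpow_le_rpow le_self_add (by positivity)
  · refine lt_of_le_of_lt ?_ h
    conv_lhs => rw [h1 B]
    exact ENNReal.rpow_le_rpow le_add_self (by positivity)

/-- Makes pairings with a fixed test function continuous in the Lorentz norm, so that weak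
derivative identities survive limits. -/
lemma lintegral_mul_le_of_morreyBound {F : Type*} [NormedAddCommGroup F]
    {f : EuclideanSpace ℝ (Fin n) → F}
    {K : ℝ≥0} {a : ℝ} (hf : MorreyBound (fun x => ‖f x‖ₑ) K a)
    {g : EuclideanSpace ℝ (Fin n) → ℝ} {c : ℝ≥0} (hg : ∀ x, ‖g x‖ₑ ≤ c) {R : ℝ} (hR : 0 < R)
    (hgR : ∀ x ∉ Metric.ball 0 R, g x = 0) :
    ∫⁻ x, ‖g x‖ₑ * ‖f x‖ₑ ≤ c * (K * ENNReal.ofReal (R ^ (n - 1 + a))) := by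
  rw [← setLIntegral_eq_of_support_subset (s := Metric.ball 0 R)]
  · refine le_trans (lintegral_mono fun x => mul_le_mul_left (hg x) _) ?_
    rw [lintegral_const_mul' _ _ ENNReal.coe_ne_top]
    exact mul_le_mul_right (hf 0 R hR) _
  · intro x hx
    by_contra h
    exact hx (by simp [hgR x h])

/-- Elements of `H₀^{1,(p,q)}`, extended by zero, are weakly differentiable on the whole space. -/
lemma MemH01.exists_isWeakGradient (hp1 : 1 < p) (hq : 1 ≤ q)
    (hΩ : IsOpen Ω) {u : EuclideanSpace ℝ (Fin n) → ℝ} (hu : MemH01 Ω p q u) :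
    ∃ G : EuclideanSpace ℝ (Fin n) → EuclideanSpace ℝ (Fin n),
      MemLorentz G p q (volume.restrict Ω) ∧
      IsWeakGradient univ (Ω.indicator u) (Ω.indicator G) := by
  obtain ⟨hu, G, hG, happ⟩ := hu
  refine ⟨G, hG, fun i => ?_⟩
  have hΩm := hΩ.measurableSet
  obtain ⟨K₁, hK₁⟩ := hu.exists_morreyBound hΩm hp1 hq
  obtain ⟨K₂, hK₂⟩ := hG.exists_morreyBound hΩm hp1 hq
  have hum : AEStronglyMeasurable (Ω.indicator u) volume :=
    (aestronglyMeasurable_indicator_iff hΩm).2 hu.1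
  have hGm : AEStronglyMeasurable (Ω.indicator G) volume :=
    (aestronglyMeasurable_indicator_iff hΩm).2 hG.1
  have hul : LocallyIntegrableOn (Ω.indicator u) univ :=
    (locallyIntegrable_of_morreyBound hum hK₁).locallyIntegrableOn _
  have hGl : LocallyIntegrableOn (fun x => Ω.indicator G x i) univ := by
    refine (locallyIntegrable_of_morreyBound
      ((EuclideanSpace.proj (𝕜 := ℝ) i).continuous.comp_aestronglyMeasurable hGm)
      (hK₂.mono (Eventually.of_forall fun x => ?_))).locallyIntegrableOn _
    rw [← ofReal_norm, ← ofReal_norm]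
    exact ENNReal.ofReal_le_ofReal (PiLp.norm_apply_le _ _)
  refine ⟨hul, hGl, fun ψ hψ => ?_⟩
  rw [setIntegral_univ, setIntegral_univ]
  set e : EuclideanSpace ℝ (Fin n) := EuclideanSpace.single i 1
  have hψ' := hψ.fderiv_apply e
  obtain ⟨c₁, hc₁⟩ := hψ.exists_enorm_le
  obtain ⟨c₂, hc₂⟩ := hψ'.exists_enorm_le
  obtain ⟨R, hR, hψR⟩ : ∃ R, 0 < R ∧ tsupport ψ ⊆ Metric.ball 0 R := by
    obtain ⟨R, hR⟩ := hψ.2.1.isBounded.subset_ball 0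
    exact ⟨max R 1, by positivity, hR.trans (Metric.ball_subset_ball (le_max_left _ _))⟩
  have hψ0 : ∀ x ∉ Metric.ball 0 R, ψ x = 0 := fun x hx =>
    image_eq_zero_of_notMem_tsupport fun h => hx (hψR h)
  have hψ'0 : ∀ x ∉ Metric.ball 0 R, fderiv ℝ ψ x e = 0 := fun x hx => by
    have : fderiv ℝ ψ x = 0 := by
      by_contra h
      exact hx (hψR (support_fderiv_subset ℝ h))
    rw [this]; rfl
  set L := lorentzMorreyConst n p q
  -- The defect in the weak derivative identity is at most a constant times `ε`, the constant
  -- depending on `ψ` but not on the approximating `φ`.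
  have key : ∀ ε : ℝ≥0, 0 < ε →
      ‖(∫ x, ψ x * Ω.indicator G x i) + ∫ x, fderiv ℝ ψ x e * Ω.indicator u x‖ₑ ≤
        ε * (((c₁ + c₂) * L : ℝ≥0) * ENNReal.ofReal (R ^ (n - 1 + (1 - n / p)))) := by
    intro ε hε
    obtain ⟨φ, hφ, hφε⟩ := happ ε (by exact_mod_cast hε)
    have hr : 0 < (min (ENNReal.ofReal p) q).toReal := by
      refine ENNReal.toReal_pos ?_ (ne_top_of_le_ne_top ENNReal.ofReal_ne_top (min_le_left _ _))
      refine (lt_min ?_ ?_).ne'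
      · simpa using by linarith
      · exact lt_of_lt_of_le one_pos hq
    obtain ⟨h1, h2⟩ := weightedSum_lt hr hφε
    have hφg : Continuous fun x => gradient φ x :=
      (InnerProductSpace.toDual ℝ _).symm.continuous.comp (hφ.1.continuous_fderiv (by simp))
    have hm1 := morreyBound_of_lorentzQuasinorm_le hΩm
      (hφ.1.continuous.aestronglyMeasurable.sub hu.1) hp1 hq
      ((lorentzQuasinorm_le_lorentzNorm _ _ _ _).trans h1.le)
    have hm2 := morreyBound_of_lorentzQuasinorm_le hΩm
      (hφg.aestronglyMeasurable.sub hG.1) hp1 hq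
      ((lorentzQuasinorm_le_lorentzNorm _ _ _ _).trans h2.le)
    -- As `φ` vanishes off `Ω`, extending the difference by zero is subtracting the extension of
    -- `u`. No boundary term appears.
    have e1 : ∀ x, Ω.indicator (fun x => φ x - u x) x = φ x - Ω.indicator u x := fun x => by
      by_cases hx : x ∈ Ω
      · simp [hx]
      · simp [hx, hφ.eq_zero hx]
    have e2 : ∀ x, Ω.indicator (fun x => gradient φ x - G x) x = gradient φ x - Ω.indicator G x :=
      fun x => by
        by_cases hx : x ∈ Ω
        · simp [hx]
        · simp [hx, hφ.gradient_eq_zero hx]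
    have hφl : LocallyIntegrableOn φ univ := hφ.1.continuous.locallyIntegrable.locallyIntegrableOn _
    have hφ'l : LocallyIntegrableOn (fun x => fderiv ℝ φ x e) univ :=
      ((hφ.fderiv_apply e).1.continuous.locallyIntegrable).locallyIntegrableOn _
    have hparts : ∫ x, ψ x * fderiv ℝ φ x e = -∫ x, fderiv ℝ ψ x e * φ x :=
      integral_mul_fderiv_eq_neg_fderiv_mul_of_integrable (hψ'.integrable_mul hφl)
        (hψ.integrable_mul hφ'l) (hψ.integrable_mul hφl)
        (fun x _ => hψ.1.differentiable (by simp) x) (fun x _ => hφ.1.differentiable (by simp) x)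
    have hid : (∫ x, ψ x * Ω.indicator G x i) + ∫ x, fderiv ℝ ψ x e * Ω.indicator u x =
        -((∫ x, ψ x * (fderiv ℝ φ x e - Ω.indicator G x i)) +
          ∫ x, fderiv ℝ ψ x e * (φ x - Ω.indicator u x)) := by
      simp only [mul_sub]
      rw [integral_sub (hψ.integrable_mul hφ'l) (hψ.integrable_mul hGl),
        integral_sub (hψ'.integrable_mul hφl) (hψ'.integrable_mul hul), hparts]
      ring
    rw [hid, enorm_neg]
    have b1 : ‖∫ x, ψ x * (fderiv ℝ φ x e - Ω.indicator G x i)‖ₑ ≤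
        c₁ * ((L * ε : ℝ≥0) * ENNReal.ofReal (R ^ (n - 1 + (1 - n / p)))) := by
      refine (enorm_integral_le_lintegral_enorm _).trans (le_trans (lintegral_mono fun x => ?_)
        (lintegral_mul_le_of_morreyBound hm2 hc₁ hR hψ0))
      rw [enorm_mul, Pi.sub_def, e2, ← gradient_apply, ← PiLp.sub_apply]
      gcongr
      rw [← ofReal_norm, ← ofReal_norm]
      exact ENNReal.ofReal_le_ofReal (PiLp.norm_apply_le _ _)
    have b2 : ‖∫ x, fderiv ℝ ψ x e * (φ x - Ω.indicator u x)‖ₑ ≤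
        c₂ * ((L * ε : ℝ≥0) * ENNReal.ofReal (R ^ (n - 1 + (1 - n / p)))) := by
      refine (enorm_integral_le_lintegral_enorm _).trans (le_trans (lintegral_mono fun x => ?_)
        (lintegral_mul_le_of_morreyBound hm1 hc₂ hR hψ'0))
      rw [enorm_mul, Pi.sub_def, e1]
    refine (enorm_add_le _ _).trans ((add_le_add b1 b2).trans (le_of_eq ?_))
    push_cast
    ring
  have hzero : (∫ x, ψ x * Ω.indicator G x i) + ∫ x, fderiv ℝ ψ x e * Ω.indicator u x = 0 := by
    rw [← enorm_eq_zero]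
    set D := (((c₁ + c₂) * L : ℝ≥0) : ℝ≥0∞) * ENNReal.ofReal (R ^ (n - 1 + (1 - n / p))) with hD
    have hlim : Tendsto (fun ε : ℝ≥0 => (ε : ℝ≥0∞) * D) (𝓝[>] 0) (𝓝 0) := by
      have h1 : Tendsto (fun ε : ℝ≥0 => (ε : ℝ≥0∞)) (𝓝[>] 0) (𝓝 ((0 : ℝ≥0) : ℝ≥0∞)) :=
        (ENNReal.continuous_coe.tendsto 0).mono_left nhdsWithin_le_nhds
      have h2 := ENNReal.Tendsto.mul_const h1 (b := D)
        (Or.inr (ENNReal.mul_ne_top ENNReal.coe_ne_top ENNReal.ofReal_ne_top))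
      simpa using h2
    exact le_antisymm (ge_of_tendsto hlim (by
      filter_upwards [self_mem_nhdsWithin] with ε hε using key ε hε)) zero_le
  linarith

end Final

end SobolevLorentz

/-! ### The main theorem -/

open SobolevLorentz
theorem mainTheorem3 (n : ℕ) (p : ℝ) (q : ℝ≥0∞) (hn : 1 < n) (hp : (n : ℝ) < p) (hq : 1 ≤ q) :
    -- (i), (iii), (iv), with one constant depending only on `n`, `p`, `q`
    (∃ C : ℝ≥0, 0 < C ∧
      (∀ Ω : Set (EuclideanSpace ℝ (Fin n)), IsOpen Ω →
        ∀ u : EuclideanSpace ℝ (Fin n) → ℝ, MemW1 Ω p q u → CompactlySupportedIn Ω u →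
          ∃ w : EuclideanSpace ℝ (Fin n) → ℝ, IsVersion Ω w u ∧ MemHolderClosure (1 - n / p) Ω w ∧
            ∀ G : EuclideanSpace ℝ (Fin n) → EuclideanSpace ℝ (Fin n), IsWeakGradient Ω u G →
              holderSeminorm (1 - n / p) (closure Ω) w ≤
                C * lorentzQuasinorm G p q (volume.restrict Ω)) ∧
      (∀ (u : EuclideanSpace ℝ (Fin n) → ℝ)
          (G : EuclideanSpace ℝ (Fin n) → EuclideanSpace ℝ (Fin n)),
        MemW1Loc univ p q u → IsWeakGradient univ u G → MemLorentz G p q volume →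
          ∃ w : EuclideanSpace ℝ (Fin n) → ℝ, IsVersion univ w u ∧ MemHolderClosure (1 - n / p) univ w ∧
            holderSeminorm (1 - n / p) univ w ≤ C * lorentzQuasinorm G p q volume) ∧
      (∀ Ω : Set (EuclideanSpace ℝ (Fin n)), IsOpen Ω →
        ∀ u : EuclideanSpace ℝ (Fin n) → ℝ, MemH01 Ω p q u →
          ∃ w : EuclideanSpace ℝ (Fin n) → ℝ, IsVersion Ω w u ∧ MemHolderClosure (1 - n / p) Ω w ∧
            (∃ G : EuclideanSpace ℝ (Fin n) → EuclideanSpace ℝ (Fin n), IsWeakGradient Ω u G) ∧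
            ∀ G : EuclideanSpace ℝ (Fin n) → EuclideanSpace ℝ (Fin n), IsWeakGradient Ω u G →
              holderSeminorm (1 - n / p) (closure Ω) w ≤
                C * lorentzQuasinorm G p q (volume.restrict Ω))) ∧
    -- (ii)
    (∀ Ω : Set (EuclideanSpace ℝ (Fin n)), IsOpen Ω →
      ∀ u : EuclideanSpace ℝ (Fin n) → ℝ, MemW1Loc Ω p q u →
        ∃ w : EuclideanSpace ℝ (Fin n) → ℝ, IsVersion Ω w u ∧
          LocallyHolder (1 - n / p) Ω w) := by 
  have hn0 : 0 < n := by omega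
  have hn' : (1 : ℝ) < n := by exact_mod_cast hn
  have hp1 : 1 < p := hn'.trans hp
  have ha1 : 0 < 1 - n / p := by
    rw [sub_pos, div_lt_one (by linarith)]
    exact hp
  obtain ⟨a, ha⟩ : ∃ a : ℝ≥0, (a : ℝ) = 1 - n / p := ⟨⟨_, ha1.le⟩, rfl⟩
  have ha0 : 0 < a := by
    rw [← ha] at ha1
    exact_mod_cast ha1
  rw [← ha]
  set C : ℝ≥0 := (morreyConst n a).toNNReal * lorentzMorreyConst n p q with hC
  have hCle : ∀ M : ℝ≥0, (((morreyConst n a).toNNReal * (lorentzMorreyConst n p q * M) : ℝ≥0) :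
      ℝ≥0∞) ≤ ((C + 1 : ℝ≥0) : ℝ≥0∞) * M := fun M => by
    rw [← mul_assoc, ← hC]
    exact_mod_cast mul_le_mul_left (le_self_add : C ≤ C + 1) M
  -- Adding 1 gives positivity without a lower bound for `C`.
  refine ⟨⟨C + 1, by positivity, ?_, ?_, ?_⟩, ?_⟩
  · intro Ω hΩ u hu hsupp
    obtain ⟨v, hvu, hv⟩ := exists_holderWith_of_compactlySupported hn0 hΩ ha0 hsupp
    obtain ⟨G₀, hG₀, hG₀i⟩ := hu.2
    obtain ⟨K₀, hK₀⟩ := exists_morreyBound_of_components hΩ.measurableSet hG₀i hp1 hq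
    rw [← ha] at hK₀
    obtain ⟨w, hw, hwv⟩ := hv G₀ K₀ hG₀ hK₀
    refine ⟨w, EventuallyEq.trans (ae_restrict_of_ae hwv) hvu, memHolderClosure_of_holderWith ha0 hw,
      fun G hG => ?_⟩
    rcases eq_or_ne (lorentzQuasinorm G p q (volume.restrict Ω)) ∞ with htop | htop
    · rw [htop, ENNReal.mul_top (by simp)]
      exact le_top
    · lift lorentzQuasinorm G p q (volume.restrict Ω) to ℝ≥0 using htop with M hM
      have hK := morreyBound_of_lorentzQuasinorm_le hΩ.measurableSet hG.aestronglyMeasurable hp1 hq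
        hM.ge
      rw [← ha] at hK
      -- The version `w` came from the gradient `G₀`, possibly with a worse constant. The version
      -- `w'` from `G` has the right one and equals `w`, both being continuous and almost everywhere
      -- equal to `v`.
      obtain ⟨w', hw', hwv'⟩ := hv G _ hG hK
      have heq : w = w' := (Continuous.ae_eq_iff_eq volume (hw.continuous ha0)
        (hw'.continuous ha0)).1 (hwv.trans hwv'.symm)
      rw [heq]
      exact (holderSeminorm_le hw' _).trans (hCle M)
  · intro u G _ hG hGL
    have htop : lorentzQuasinorm G p q volume ≠ ∞ :=
      ((lorentzQuasinorm_le_lorentzNorm _ _ _ _).trans_lt hGL.2).ne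
    lift lorentzQuasinorm G p q volume to ℝ≥0 using htop with M hM
    have hK := morreyBound_of_lorentzQuasinorm_le MeasurableSet.univ hG.aestronglyMeasurable hp1 hq
      (M := M) (by rw [Measure.restrict_univ, hM])
    rw [← ha, indicator_univ] at hK
    obtain ⟨w, hw, hwu⟩ := exists_holderWith_of_morreyBound hG (hG.locallyIntegrable hn0) ha0 hK
    exact ⟨w, ae_restrict_of_ae hwu, memHolderClosure_of_holderWith ha0 hw,
      (holderSeminorm_le hw _).trans (hCle M)⟩
  · intro Ω hΩ u hu
    obtain ⟨G, hGL, hG⟩ := hu.exists_isWeakGradient hp1 hq hΩ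
    have hGΩ := hG.restrict hΩ.measurableSet
    have htop : lorentzQuasinorm G p q (volume.restrict Ω) ≠ ∞ :=
      ((lorentzQuasinorm_le_lorentzNorm _ _ _ _).trans_lt hGL.2).ne
    have hK := morreyBound_of_lorentzQuasinorm_le hΩ.measurableSet hGL.1 hp1 hq
      (ENNReal.coe_toNNReal htop).ge
    rw [← ha] at hK
    obtain ⟨w, hw, hwu⟩ := exists_holderWith_of_morreyBound hG (hG.locallyIntegrable hn0) ha0 hK
    refine ⟨w, EventuallyEq.trans (ae_restrict_of_ae hwu) (indicator_ae_eq_restrict hΩ.measurableSet),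
      memHolderClosure_of_holderWith ha0 hw, ⟨G, hGΩ⟩, fun H hH => ?_⟩
    -- By uniqueness, `H` has the same quasinorm as the limit gradient `G`.
    rw [← lorentzQuasinorm_congr_ae (hGΩ.ae_eq hΩ hH), ← ENNReal.coe_toNNReal htop]
    exact (holderSeminorm_le hw _).trans (hCle _)
  · intro Ω hΩ u hu
    have hloc : ∀ K : Set (EuclideanSpace ℝ (Fin n)), IsCompact K → K ⊆ Ω →
        ∃ (U : Set (EuclideanSpace ℝ (Fin n))) (v : EuclideanSpace ℝ (Fin n) → ℝ) (C : ℝ≥0),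
          IsOpen U ∧ K ⊆ U ∧ HolderWith C a v ∧ v =ᵐ[volume.restrict U] u := by
      intro K hK hKΩ
      obtain ⟨V, hV, hKV, hVΩ, hVc⟩ := exists_open_between_and_isCompact_closure hK hΩ hKΩ
      exact exists_holderWith_nhds_of_memW1 hn0 hp1 hq ha ha0 hV (hu V hV hVc hVΩ) hK hKV
    obtain ⟨w, hwu, hw⟩ := exists_version_eqOn hΩ u fun x hx => by
      obtain ⟨U, v, C, hU, hxU, hv, hvu⟩ := hloc {x} isCompact_singleton (singleton_subset_iff.2 hx)
      exact ⟨U, v, hU, hxU rfl, hv.continuous ha0, hvu⟩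
    refine ⟨w, hwu, fun K hK hKΩ => ?_⟩
    -- A single Hölder representative near all of `K` is used, so pairs of distant points of `K`
    -- need no chaining.
    obtain ⟨U, v, C, hU, hKU, hv, hvu⟩ := hloc K hK hKΩ
    rw [holderSeminorm_congr ((hw U v hU (hv.continuous ha0) hvu).mono (subset_inter hKΩ hKU))]
    exact (holderSeminorm_le hv K).trans_lt ENNReal.coe_lt_top
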